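/- Let $n\ge 1$ and $0<\lambda\le 1\le\Lambda$. Points of $\mathbb R^n\times\mathbb R$ are written $(x,t)$, $B_1$ is the open unit ball of $\mathbb R^n$, $Q_1=B_1\times(-1,0]$, $\overline Q_1=\overline B_1\times[-1,0]$, $|E|$ is $(n+1)$-dimensional Lebesgue (outer) measure, and $\mathrm{Sym}(n)$ is the space of real symmetric $n\times n$ matrices with the spectral norm. Put $$PB_T^{-\theta}(x_0,t_0)=\{(x,t):\ \theta|x-x_0|^2\le t_0-t\le T\},\qquad \eta_2=4^{-(1+n/2)}(\sqrt2+1)^{-n},\qquad c_0=\frac{\lambda^2}{\Lambda^2(n+5)}\,e^{-10^3\Lambda n/\lambda}.$$ A function $\varphi$ contacts $v$ from below (resp. above) at $(x,t)$ if $\varphi(x,t)=v(x,t)$ and $\varphi<v$ (resp. $\varphi>v$) at all $(\xi,\tau)$ with $\xi\in B_1$, $\tau<t$. For a bounded $u\in C(\overline B_1\times\mathbb R)$ and $a>0$, let $A_a$ be the set of $(x,t)\in\overline B_1\times\mathbb R$ at which, for some $(y,s)\in\overline Q_1$, the parabola $-\frac a2|\xi-y|^2+a(\tau-s)$ contacts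 $u-\inf_{Q_1}u$ from below. The function $u$ is locally uniformly semi-concave if for every compact $Z\subset Q_1$ there is $b>0$ such that at each $(x,t)\in Z$ some parabola $\frac b2|\xi-y|^2-b(\tau-s)$, $(y,s)\in\mathbb R^n\times\mathbb R$, contacts $u$ from above. Let $\delta>0$. We say that $F:\mathrm{Sym}(n)\to\mathbb R$ satisfies (H) if $F(0)=0$ and, for all $M$ with $\|M\|<\delta$ and all $N\ge0$: $F(M+N)\ge F(M)$, and moreover $\lambda\|N\|\le F(M+N)-F(M)\le\Lambda\|N\|$ if $\|N\|\le\delta$. The inequality $F(D^2u)-u_t\le0$ in $Q_1$ is understood in the viscosity sense: $F(D^2\varphi(x,t))-\varphi_t(x,t)\le0$ whenever $(x,t)\in Q_1$ and $\varphi$ is a smooth function with $\varphi(x,t)=u(x,t)$ and $\varphi\le u$ at all points $(\xi,\tau)$ near $(x,t)$ with $\tau\le t$. **Proposition.** There is a constant $c_1\in(0,1)$ depending only on $n,\lambda,\Lambda$ such that the following holds. Let $\delta>0$, let $F$ satisfy (H), let $u\in C(\overline B_1\times\mathbb R)$ be bounded and locally uniformly semi-concave with $F(D^2u)-u_t\le0$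 in $Q_1$ in the viscosity sense, let $\frac34\le\theta\le4$, $T_0>0$ and $PB_{T_0}^{-\theta}(x_0,t_0)\subset Q_1$, and let $a\in(0,c_0\delta)$ be such that $(x_0,t_0)\in A_a$. Then for every integer $k\ge0$ with $c_1^{-k}a\le c_0\delta$, $$\bigl|PB_{T_0}^{-\theta}(x_0,t_0)\setminus A_{c_1^{-k}a}\bigr|\le(1-\eta_2c_1)^k\,\bigl|PB_{T_0}^{-\theta}(x_0,t_0)\bigr|.$$ -/

import Mathlib

open Set Filter Topology MeasureTheory
open scoped ContDiff

namespace ParabolicContact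

noncomputable section

/-- The space `ℝⁿ` with its Euclidean norm. Space-time `ℝⁿ × ℝ` carries the product topology and
the product Lebesgue measure (`volume`), i.e. `(n+1)`-dimensional Lebesgue measure. -/
abbrev Space (n : ℕ) : Type := EuclideanSpace ℝ (Fin n)

/-- Real symmetric `n × n` matrices (over `ℝ`, the star operation on matrices is the transpose). -/
abbrev SymMat (n : ℕ) : Type := selfAdjoint (Matrix (Fin n) (Fin n) ℝ)

/-- The spectral norm of a symmetric matrix: its operator norm on Euclidean `ℝⁿ`. -/
def specNorm {n : ℕ} (M : SymMat n) : ℝ :=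
  ‖Matrix.toEuclideanCLM (𝕜 := ℝ) (n := Fin n) (M : Matrix (Fin n) (Fin n) ℝ)‖

/-- `N ≥ 0` for a symmetric matrix. -/
def Nonneg {n : ℕ} (N : SymMat n) : Prop := (N : Matrix (Fin n) (Fin n) ℝ).PosSemidef

/-- The structure conditions on an operator `F : Sym(n) → ℝ` in the `δ`-neighbourhood of `0`:
ellipticity, uniform ellipticity with constants `lam ≤ Lam`, and the fact that the zero function
solves `F(D²φ) - φ_t = 0`. Nothing is asked about `F` away from matrices of norm less than `δ`,
beyond the one-sided comparison `F (M + N) ≥ F M`. -/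
structure StructureConditions {n : ℕ} (lam Lam δ : ℝ) (F : SymMat n → ℝ) : Prop where
  elliptic : ∀ M : SymMat n, specNorm M < δ → ∀ N : SymMat n, Nonneg N → F M ≤ F (M + N)
  uniformly_elliptic : ∀ M : SymMat n, specNorm M < δ → ∀ N : SymMat n, Nonneg N → specNorm N ≤ δ →
    lam * specNorm N ≤ F (M + N) - F M ∧ F (M + N) - F M ≤ Lam * specNorm N
  zero_solution : F 0 = 0

/-- The parabolic cylinder `Q₁ = B₁ × (-1, 0]`. -/
def Q₁ (n : ℕ) : Set (Space n × ℝ) := Metric.ball 0 1 ×ˢ Ioc (-1) 0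

/-- The closed cylinder `B̄₁ × [-1, 0]`. -/
def closedQ₁ (n : ℕ) : Set (Space n × ℝ) := Metric.closedBall 0 1 ×ˢ Icc (-1) 0

/-- The (downward) parabolic ball `PB_T^{-θ}(x, t)`. -/
def lowerPB {n : ℕ} (θ T : ℝ) (x : Space n) (t : ℝ) : Set (Space n × ℝ) :=
  {z | θ * ‖z.1 - x‖ ^ 2 ≤ t - z.2 ∧ t - z.2 ≤ T}

/-- The concave parabola of opening `a` and vertex `(y, s)`. -/
def concaveParabola {n : ℕ} (a : ℝ) (y : Space n) (s : ℝ) (z : Space n × ℝ) : ℝ :=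
  -(a / 2) * ‖z.1 - y‖ ^ 2 + a * (z.2 - s)

/-- The convex parabola of opening `b` and vertex `(y, s)`. -/
def convexParabola {n : ℕ} (b : ℝ) (y : Space n) (s : ℝ) (z : Space n × ℝ) : ℝ :=
  b / 2 * ‖z.1 - y‖ ^ 2 - b * (z.2 - s)

/-- `φ` contacts `u` at `(x, t)` from below; only times `τ < t` are compared. -/
def ContactsBelow {n : ℕ} (φ u : Space n × ℝ → ℝ) (x : Space n) (t : ℝ) : Prop :=
  (∀ ξ ∈ Metric.ball (0 : Space n) 1, ∀ τ < t, φ (ξ, τ) < u (ξ, τ)) ∧ φ (x, t) = u (x, t)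

/-- `φ` contacts `u` at `(x, t)` from above; only times `τ < t` are compared. -/
def ContactsAbove {n : ℕ} (φ u : Space n × ℝ → ℝ) (x : Space n) (t : ℝ) : Prop :=
  (∀ ξ ∈ Metric.ball (0 : Space n) 1, ∀ τ < t, u (ξ, τ) < φ (ξ, τ)) ∧ φ (x, t) = u (x, t)

/-- The contact set `A_a(E, u)`. The minimum of `u` over `Q₁` is written as an infimum
(`u` is bounded in all uses). -/
def contactSet {n : ℕ} (a : ℝ) (E : Set (Space n × ℝ)) (u : Space n × ℝ → ℝ) :
    Set (Space n × ℝ) :=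
  {z | z.1 ∈ Metric.closedBall (0 : Space n) 1 ∧ ∃ y s, (y, s) ∈ E ∧
    ContactsBelow (concaveParabola a y s) (fun w => u w - sInf (u '' Q₁ n)) z.1 z.2}

/-- Local uniform semi-concavity in `Q₁`. -/
def LocallyUniformlySemiconcave {n : ℕ} (u : Space n × ℝ → ℝ) : Prop :=
  ∀ Z : Set (Space n × ℝ), IsCompact Z → Z ⊆ Q₁ n → ∃ b : ℝ, 0 < b ∧
    ∀ z ∈ Z, ∃ y s, ContactsAbove (convexParabola b y s) u z.1 z.2

/-- The `(i, j)` entry of the Hessian of `φ` in the space variables at `(x, t)`. -/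
def spatialHessian {n : ℕ} (φ : Space n × ℝ → ℝ) (x : Space n) (t : ℝ) (i j : Fin n) : ℝ :=
  iteratedFDeriv ℝ 2 (fun ξ : Space n => φ (ξ, t)) x
    ![EuclideanSpace.single i 1, EuclideanSpace.single j 1]

/-- `F(D²u) - u_t ≤ 0` in `Q₁` in the viscosity sense: whenever a smooth `φ` touches `u` from below
at a point `(x, t)` of `Q₁`, locally and for times `τ ≤ t`, one has
`F(D²φ(x, t)) - φ_t(x, t) ≤ 0`. -/
def IsViscositySupersolution {n : ℕ} (F : SymMat n → ℝ) (u : Space n × ℝ → ℝ) : Prop :=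
  ∀ (x : Space n) (t : ℝ), (x, t) ∈ Q₁ n → ∀ φ : Space n × ℝ → ℝ, ContDiff ℝ ∞ φ →
    φ (x, t) = u (x, t) → (∀ᶠ z in 𝓝 (x, t), z.2 ≤ t → φ z ≤ u z) →
    ∀ M : SymMat n, (∀ i j, (M : Matrix (Fin n) (Fin n) ℝ) i j = spatialHessian φ x t i j) →
      F M - deriv (fun τ : ℝ => φ (x, τ)) t ≤ 0

/-- The constant `c₀ = λ² / (Λ² (n+5)) · exp(-10³ Λ n / λ)`. -/
def c₀ (n : ℕ) (lam Lam : ℝ) : ℝ :=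
  lam ^ 2 / (Lam ^ 2 * ((n : ℝ) + 5)) * Real.exp (-(10 ^ 3 * Lam * n / lam))

/-- The dimensional constant `η₂ = 4^{-(1+n/2)} (√2+1)^{-n}`. -/
def η₂ (n : ℕ) : ℝ := (4 : ℝ) ^ (-(1 + (n : ℝ) / 2)) * (√2 + 1) ^ (-(n : ℝ))

end

end ParabolicContact

open ParabolicContact

/-!
Suppose that two paraboloids of the same opening touch a supersolution from below at points of
parabolic distance at most `r`. Then they differ by an affine function of size `O(r²)`: otherwise
their maximum has a sharp crease, and smoothing it gives a strict subsolution below the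
supersolution that crosses it. Hence vertices are controlled by contact points, and by Vitali's
covering lemma the measure of a set of vertices is at most a constant times that of their contact
points.

Conversely, a travelling bump that decays exponentially in time is a barrier showing that, before
a contact time, the supersolution comes close to the touching paraboloid in a smaller cylinder.
Steeper paraboloids added there still touch, for a set of vertices of comparable measure, so that
the contact set of larger opening fills a fixed fraction of the cylinder. Going up from a point
outside `A_a` to the first point of `A_a`, one finds such a cylinder disjoint from `A_a`; by
Vitali again, each increase of the opening gains a fixed fraction of the complement.

Limits of contact points only give touching with `≤`, so the argument runs with these closed
contact sets; a strictly larger opening makes the contact strict.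
-/

namespace ParabolicContact

open scoped RealInnerProductSpace

section Matrices

variable {n : ℕ}

/-- The quadratic form of a symmetric matrix. -/
noncomputable def quadForm (M : SymMat n) (v : Space n) : ℝ :=
  ⟪v, Matrix.toEuclideanCLM (𝕜 := ℝ) (n := Fin n) (M : Matrix (Fin n) (Fin n) ℝ) v⟫

/-- The symmetric matrix `g ⊗ g` of rank at most one. -/
noncomputable def dyad (g : Space n) : SymMat n :=
  ⟨Matrix.vecMulVec g.ofLp g.ofLp, by
    rw [selfAdjoint.mem_iff, Matrix.star_eq_conjTranspose, Matrix.conjTranspose_vecMulVec]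
    simp⟩

lemma toEuclideanCLM_dyad (g : Space n) :
    Matrix.toEuclideanCLM (𝕜 := ℝ) (n := Fin n) (dyad g : Matrix (Fin n) (Fin n) ℝ)
      = InnerProductSpace.rankOne ℝ g g := by
  ext v i
  simp [dyad, Matrix.ofLp_toEuclideanCLM, Matrix.vecMulVec_mulVec,
    EuclideanSpace.inner_eq_star_dotProduct, dotProduct_comm, mul_comm]

lemma specNorm_dyad (g : Space n) : specNorm (dyad g) = ‖g‖ ^ 2 := by
  rw [specNorm, toEuclideanCLM_dyad, InnerProductSpace.norm_rankOne, sq]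

lemma specNorm_smul_one_le (k : ℝ) : specNorm (k • (1 : SymMat n)) ≤ |k| := by
  have hsmul : ((k • (1 : SymMat n) : SymMat n) : Matrix (Fin n) (Fin n) ℝ) = k • 1 := by simp
  rw [specNorm, hsmul, map_smul, map_one, norm_smul, Real.norm_eq_abs]
  exact mul_le_of_le_one_right (abs_nonneg k) ContinuousLinearMap.norm_id_le

lemma specNorm_add_le (M N : SymMat n) : specNorm (M + N) ≤ specNorm M + specNorm N := by
  simpa [specNorm] using norm_add_le _ _

lemma quadForm_dyad (g v : Space n) : quadForm (dyad g) v = ⟪g, v⟫ ^ 2 := by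
  rw [quadForm, toEuclideanCLM_dyad, InnerProductSpace.rankOne_apply, inner_smul_right,
    real_inner_comm v g, sq]

lemma quadForm_smul_one (k : ℝ) (v : Space n) : quadForm (k • (1 : SymMat n)) v = k * ‖v‖ ^ 2 := by
  have hsmul : ((k • (1 : SymMat n) : SymMat n) : Matrix (Fin n) (Fin n) ℝ) = k • 1 := by simp
  simp [quadForm, hsmul, inner_smul_right]

lemma quadForm_add (M N : SymMat n) (v : Space n) :
    quadForm (M + N) v = quadForm M v + quadForm N v := by
  simp [quadForm, inner_add_right]

lemma quadForm_sub (M N : SymMat n) (v : Space n) :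
    quadForm (M - N) v = quadForm M v - quadForm N v := by
  simp [quadForm, inner_sub_right]

lemma nonneg_of_quadForm_nonneg {M : SymMat n} (h : ∀ v, 0 ≤ quadForm M v) : Nonneg M := by
  refine Matrix.PosSemidef.of_dotProduct_mulVec_nonneg M.2 fun x => ?_
  have hx := h (WithLp.toLp 2 x)
  rwa [quadForm, Matrix.inner_toEuclideanCLM] at hx

lemma nonneg_smul_one {k : ℝ} (hk : 0 ≤ k) : Nonneg (k • (1 : SymMat n)) :=
  nonneg_of_quadForm_nonneg fun v => by rw [quadForm_smul_one]; positivity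

lemma nonneg_dyad (g : Space n) : Nonneg (dyad g) :=
  nonneg_of_quadForm_nonneg fun v => by rw [quadForm_dyad]; positivity

lemma StructureConditions.mono {lam lam' Lam Lam' δ : ℝ} {F : SymMat n → ℝ}
    (hF : StructureConditions lam Lam δ F) (hlam : lam' ≤ lam) (hLam : Lam ≤ Lam') :
    StructureConditions lam' Lam' δ F where
  elliptic := hF.elliptic
  uniformly_elliptic M hM N hN hNδ :=
    have hFN := hF.uniformly_elliptic M hM N hN hNδ
    ⟨(mul_le_mul_of_nonneg_right hlam (norm_nonneg _)).trans hFN.1,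
      hFN.2.trans (mul_le_mul_of_nonneg_right hLam (norm_nonneg _))⟩
  zero_solution := hF.zero_solution

lemma StructureConditions.le_apply {lam Lam δ : ℝ} {F : SymMat n → ℝ}
    (hF : StructureConditions lam Lam δ F) (hLam : 0 ≤ Lam) {k : ℝ} {g : Space n} {M : SymMat n}
    (hk : 0 ≤ k) (hkg : k + ‖g‖ ^ 2 < δ)
    (hM : ∀ v, -k * ‖v‖ ^ 2 + ⟪g, v⟫ ^ 2 ≤ quadForm M v) :
    lam * ‖g‖ ^ 2 - Lam * k ≤ F M := by
  have hg : 0 ≤ ‖g‖ ^ 2 := by positivity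
  have hnorm : specNorm (k • (1 : SymMat n)) ≤ k := by
    simpa [abs_of_nonneg hk] using specNorm_smul_one_le (n := n) k
  have hnorm_neg : specNorm (-k • (1 : SymMat n)) ≤ k := by
    simpa [abs_of_nonneg hk] using specNorm_smul_one_le (n := n) (-k)
  have from_neg : -F (-k • (1 : SymMat n)) ≤ Lam * k := by
    have hF0 := (hF.uniformly_elliptic (-k • 1) (by linarith) (k • 1) (nonneg_smul_one hk)
      (by linarith)).2
    rw [← add_smul, neg_add_cancel, zero_smul, hF.zero_solution, zero_sub] at hF0
    exact hF0.trans (mul_le_mul_of_nonneg_left hnorm hLam)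
  have add_dyad : lam * ‖g‖ ^ 2 ≤ F (-k • 1 + dyad g) - F (-k • (1 : SymMat n)) := by
    simpa only [specNorm_dyad] using (hF.uniformly_elliptic (-k • 1) (by linarith) (dyad g)
      (nonneg_dyad g) (by rw [specNorm_dyad]; linarith)).1
  have to_M : F (-k • 1 + dyad g) ≤ F M := by
    have hsum : specNorm (-k • 1 + dyad g) < δ := by
      linarith [specNorm_add_le (-k • 1) (dyad g), specNorm_dyad g]
    have hle := hF.elliptic _ hsum (M - (-k • 1 + dyad g)) (nonneg_of_quadForm_nonneg fun v => by
      rw [quadForm_sub, quadForm_add, quadForm_smul_one, quadForm_dyad]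
      linarith [hM v])
    rwa [add_sub_cancel] at hle
  linarith

end Matrices

section Hessian

variable {n : ℕ}

lemma contDiff_slice {φ : Space n × ℝ → ℝ} (hφ : ContDiff ℝ ∞ φ) (t : ℝ) :
    ContDiff ℝ ∞ fun ξ : Space n => φ (ξ, t) :=
  hφ.comp (contDiff_id.prodMk contDiff_const)

lemma spatialHessian_eq (φ : Space n × ℝ → ℝ) (x : Space n) (t : ℝ) (i j : Fin n) :
    spatialHessian φ x t i j = fderiv ℝ (fderiv ℝ fun ξ : Space n => φ (ξ, t)) x
      (EuclideanSpace.single i 1) (EuclideanSpace.single j 1) := by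
  simp [spatialHessian, iteratedFDeriv_two_apply]

lemma spatialHessian_add_const (φ : Space n × ℝ → ℝ) (c : ℝ) (x : Space n) (t : ℝ) (i j : Fin n) :
    spatialHessian (fun z => φ z + c) x t i j = spatialHessian φ x t i j := by
  have hfderiv : (fderiv ℝ fun ξ : Space n => φ (ξ, t) + c) = fderiv ℝ fun ξ => φ (ξ, t) :=
    funext fun ξ => fderiv_add_const c
  simp only [spatialHessian_eq, hfderiv]

lemma exists_symMat_eq_spatialHessian {φ : Space n × ℝ → ℝ} (hφ : ContDiff ℝ ∞ φ) (x : Space n)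
    (t : ℝ) :
    ∃ M : SymMat n, ∀ i j, (M : Matrix (Fin n) (Fin n) ℝ) i j = spatialHessian φ x t i j := by
  refine ⟨⟨Matrix.of fun i j => spatialHessian φ x t i j, ?_⟩, fun i j => rfl⟩
  have hsymm : IsSymmSndFDerivAt ℝ (fun ξ : Space n => φ (ξ, t)) x :=
    (contDiff_slice hφ t).contDiffAt.isSymmSndFDerivAt <| by
      rw [minSmoothness_of_isRCLikeNormedField]
      exact WithTop.coe_le_coe.2 (le_top : (2 : ℕ∞) ≤ ⊤)
  rw [selfAdjoint.mem_iff, Matrix.star_eq_conjTranspose]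
  ext i j
  simp only [Matrix.conjTranspose_apply, Matrix.of_apply, star_trivial, spatialHessian_eq]
  exact hsymm.eq _ _

lemma iteratedDeriv_two_comp_line {E : Type*} [NormedAddCommGroup E] [NormedSpace ℝ E] {f : E → ℝ}
    (hf : ContDiff ℝ 2 f) (x v : E) :
    iteratedDeriv 2 (fun s : ℝ => f (x + s • v)) 0 = fderiv ℝ (fderiv ℝ f) x v v := by
  have hline (s : ℝ) : HasDerivAt (fun s : ℝ => x + s • v) v s := by
    simpa using ((hasDerivAt_id s).smul_const v).const_add x
  have hderiv : deriv (fun s : ℝ => f (x + s • v)) = fun s => fderiv ℝ f (x + s • v) v :=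
    funext fun s => ((hf.differentiable (by simp) _).hasFDerivAt.comp_hasDerivAt s (hline s)).deriv
  have hderiv' := (((hf.fderiv_right (m := 1) (by norm_num)).differentiable (by simp)
    _).hasFDerivAt.comp_hasDerivAt 0 (hline 0)).clm_apply (hasDerivAt_const (0 : ℝ) v)
  rw [iteratedDeriv_succ, iteratedDeriv_one, hderiv]
  simpa using hderiv'.deriv

lemma quadForm_eq_iteratedDeriv {φ : Space n × ℝ → ℝ} (hφ : ContDiff ℝ ∞ φ) {x : Space n} {t : ℝ}
    {M : SymMat n}
    (hM : ∀ i j, (M : Matrix (Fin n) (Fin n) ℝ) i j = spatialHessian φ x t i j) (v : Space n) :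
    quadForm M v = iteratedDeriv 2 (fun s : ℝ => φ (x + s • v, t)) 0 := by
  have hv : v = ∑ i, v i • (EuclideanSpace.single i (1 : ℝ) : Space n) := by
    ext j
    simp [Pi.single_apply]
  rw [iteratedDeriv_two_comp_line ((contDiff_slice hφ t).of_le (WithTop.coe_le_coe.2 le_top)),
    quadForm, Matrix.inner_toEuclideanCLM]
  conv_rhs => rw [hv]
  simp only [dotProduct, Matrix.mulVec, hM, spatialHessian_eq, map_sum, map_smul,
    sum_apply, smul_apply, smul_eq_mul, Finset.mul_sum]
  rw [Finset.sum_comm]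
  exact Finset.sum_congr rfl fun i _ => Finset.sum_congr rfl fun j _ => by ring

lemma iteratedDeriv_two_quartic (b₀ b₁ b₂ b₃ b₄ : ℝ) :
    iteratedDeriv 2 (fun s : ℝ => b₀ + b₁ * s + b₂ * s ^ 2 + b₃ * s ^ 3 + b₄ * s ^ 4) 0
      = 2 * b₂ := by
  have hderiv (c₀ c₁ c₂ c₃ c₄ s : ℝ) :
      HasDerivAt (fun s : ℝ => c₀ + c₁ * s + c₂ * s ^ 2 + c₃ * s ^ 3 + c₄ * s ^ 4)
        (c₁ + 2 * c₂ * s + 3 * c₃ * s ^ 2 + 4 * c₄ * s ^ 3) s := by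
    have h := (((((hasDerivAt_id' s).const_mul c₁).const_add c₀).fun_add
      ((hasDerivAt_pow 2 s).const_mul c₂)).fun_add ((hasDerivAt_pow 3 s).const_mul c₃)).fun_add
      ((hasDerivAt_pow 4 s).const_mul c₄)
    refine h.congr_deriv ?_
    norm_num
    ring
  rw [iteratedDeriv_succ, iteratedDeriv_one, funext fun s => (hderiv b₀ b₁ b₂ b₃ b₄ s).deriv]
  simpa using (hderiv b₁ (2 * b₂) (3 * b₃) (4 * b₄) 0 0).deriv

end Hessian

section Supersolutions

variable {n : ℕ} {lam Lam δ : ℝ} {v : Space n × ℝ → ℝ}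

/-- A strict subsolution inequality at `(x, t)` which is valid for every operator `F` satisfying the
structure conditions. The Hessian is bounded below by `-k I + g ⊗ g`, so that `F(D²Φ)` is at least
`lam |g|² - Lam k`; second derivatives are taken along lines. -/
def IsStrictSubsolutionAt (lam Lam δ : ℝ) (Φ : Space n × ℝ → ℝ) (x : Space n) (t : ℝ) : Prop :=
  ∃ (k : ℝ) (g : Space n), 0 ≤ k ∧ k + ‖g‖ ^ 2 < δ ∧
    (∀ w, -k * ‖w‖ ^ 2 + ⟪g, w⟫ ^ 2 ≤ iteratedDeriv 2 (fun s : ℝ => Φ (x + s • w, t)) 0) ∧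
    deriv (fun τ : ℝ => Φ (x, τ)) t < lam * ‖g‖ ^ 2 - Lam * k

/-- The supersolutions to which the argument applies: a strict subsolution in the sense of
`IsStrictSubsolutionAt` never touches `v` from below in `Q₁`. This replaces the operator `F` by its
ellipticity constants and the size `δ` of the neighbourhood in which they are available. -/
structure IsEllipticSupersolution (lam Lam δ : ℝ) (v : Space n × ℝ → ℝ) : Prop where
  continuousOn : ContinuousOn v (Metric.closedBall 0 1 ×ˢ univ)
  not_isStrictSubsolutionAt : ∀ (x : Space n) (t : ℝ), (x, t) ∈ Q₁ n →
    ∀ φ : Space n × ℝ → ℝ, ContDiff ℝ ∞ φ → φ (x, t) = v (x, t) →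
    (∀ᶠ z in 𝓝 (x, t), z.2 ≤ t → φ z ≤ v z) → ¬IsStrictSubsolutionAt lam Lam δ φ x t

lemma IsStrictSubsolutionAt.add_const {Φ : Space n × ℝ → ℝ} {x : Space n} {t : ℝ}
    (h : IsStrictSubsolutionAt lam Lam δ Φ x t) (c : ℝ) :
    IsStrictSubsolutionAt lam Lam δ (fun z => Φ z + c) x t := by
  obtain ⟨k, g, hk, hkg, hH, hlt⟩ := h
  refine ⟨k, g, hk, hkg, fun w => ?_, by simpa only [deriv_add_const] using hlt⟩
  refine (hH w).trans_eq ?_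
  simp only [iteratedDeriv_succ, iteratedDeriv_zero, deriv_add_const']

lemma isEllipticSupersolution_sub_const {F : SymMat n → ℝ} {u : Space n × ℝ → ℝ} (hLam : 0 ≤ Lam)
    (hF : StructureConditions lam Lam δ F) (hu : IsViscositySupersolution F u)
    (hc : ContinuousOn u (Metric.closedBall 0 1 ×ˢ univ)) (c : ℝ) :
    IsEllipticSupersolution lam Lam δ fun z => u z - c where
  continuousOn := hc.sub continuousOn_const
  not_isStrictSubsolutionAt x t hxt φ hφ heq hle := by
    rintro ⟨k, g, hk, hkg, hH, hlt⟩
    obtain ⟨M, hM⟩ := exists_symMat_eq_spatialHessian hφ x t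
    have hsuper := hu x t hxt (fun z => φ z + c) (hφ.add contDiff_const) (by simp [heq])
      (hle.mono fun w hw hwt => by linarith [hw hwt]) M
      (fun i j => by rw [hM, spatialHessian_add_const])
    rw [deriv_add_const] at hsuper
    have hFM := hF.le_apply hLam hk hkg fun w =>
      (hH w).trans_eq (quadForm_eq_iteratedDeriv hφ hM w).symm
    linarith

lemma IsEllipticSupersolution.comparison (hv : IsEllipticSupersolution lam Lam δ v)
    {K : Set (Space n × ℝ)} (hK : IsCompact K) (hKv : ContinuousOn v K) {Φ : Space n × ℝ → ℝ}
    (hΦ : ContDiff ℝ ∞ Φ)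
    (h : ∀ z ∈ K, Φ z ≤ v z ∨ (z ∈ Q₁ n ∧ (∀ᶠ w in 𝓝 z, w.2 ≤ z.2 → w ∈ K) ∧
      IsStrictSubsolutionAt lam Lam δ Φ z.1 z.2)) :
    ∀ z ∈ K, Φ z ≤ v z := by
  intro z hz
  obtain ⟨m, hm, hmin⟩ := hK.exists_isMinOn ⟨z, hz⟩ (hKv.sub hΦ.continuous.continuousOn)
  have hgap (w) (hw : w ∈ K) : v m - Φ m ≤ v w - Φ w := hmin hw
  rcases h m hm with hle | ⟨hmQ, hmK, hsub⟩
  · linarith [hgap z hz]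
  · refine absurd (hsub.add_const (v m - Φ m)) (hv.not_isStrictSubsolutionAt m.1 m.2 hmQ
      (fun w => Φ w + (v m - Φ m)) (hΦ.add contDiff_const) (by simp) ?_)
    filter_upwards [hmK] with w hw hwm
    linarith [hgap w (hw hwm)]

end Supersolutions

section Parabolas

variable {n : ℕ} {φ v : Space n × ℝ → ℝ}

/-- `φ ≤ v` on the closed unit ball at all times up to `t`. -/
def LiesBelow (φ v : Space n × ℝ → ℝ) (t : ℝ) : Prop :=
  ∀ ξ ∈ Metric.closedBall (0 : Space n) 1, ∀ τ ≤ t, φ (ξ, τ) ≤ v (ξ, τ)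

/-- Non-strict contact from below at `(x, t)`; in contrast to `ContactsBelow`, this is preserved
under limits. -/
def TouchesBelow (φ v : Space n × ℝ → ℝ) (x : Space n) (t : ℝ) : Prop :=
  LiesBelow φ v t ∧ φ (x, t) = v (x, t)

/-- The affine function of slope `g` with value `-D` at `x`. -/
noncomputable def tilt (g x : Space n) (D : ℝ) (ξ : Space n) : ℝ := ⟪g, ξ - x⟫ - D

lemma LiesBelow.mono {s t : ℝ} (h : LiesBelow φ v t) (hst : s ≤ t) : LiesBelow φ v s :=
  fun ξ hξ τ hτ => h ξ hξ τ (hτ.trans hst)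

lemma LiesBelow.le_of_mem_Q₁ {t : ℝ} (h : LiesBelow φ v t) {z : Space n × ℝ} (hz : z ∈ Q₁ n)
    (hzt : z.2 ≤ t) : φ z ≤ v z :=
  h z.1 (Metric.ball_subset_closedBall hz.1) z.2 hzt

lemma mem_closedBall_of_mem_Q₁ {z : Space n × ℝ} (hz : z ∈ Q₁ n) :
    z.1 ∈ Metric.closedBall (0 : Space n) 1 :=
  Metric.ball_subset_closedBall hz.1

lemma tilt_smul (κ : ℝ) (g x : Space n) (D : ℝ) (ξ : Space n) :
    tilt (κ • g) x (κ * D) ξ = κ * tilt g x D ξ := by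
  rw [tilt, tilt, real_inner_smul_left, mul_sub]

lemma tilt_add_smul (g x : Space n) (D : ℝ) (ξ w : Space n) (σ : ℝ) :
    tilt g x D (ξ + σ • w) = tilt g x D ξ + ⟪g, w⟫ * σ := by
  rw [tilt, tilt, add_sub_right_comm, inner_add_right, inner_smul_right]
  ring

lemma tilt_le (g x : Space n) (D : ℝ) (ξ : Space n) : tilt g x D ξ ≤ ‖g‖ * ‖ξ - x‖ - D :=
  sub_le_sub_right (real_inner_le_norm _ _) D

lemma contDiff_tilt (g x : Space n) (D : ℝ) : ContDiff ℝ ∞ (tilt g x D) :=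
  ContDiff.sub (contDiff_const.inner ℝ (contDiff_id.sub contDiff_const)) contDiff_const

lemma contDiff_concaveParabola (a : ℝ) (y : Space n) (s : ℝ) :
    ContDiff ℝ ∞ (concaveParabola a y s) := by
  unfold concaveParabola
  exact (contDiff_const.mul ((contDiff_fst.sub contDiff_const).norm_sq ℝ)).add
    (contDiff_const.mul (contDiff_snd.sub contDiff_const))

lemma norm_add_smul_sub_sq (x y w : Space n) (σ : ℝ) :
    ‖x + σ • w - y‖ ^ 2 = ‖x - y‖ ^ 2 + 2 * ⟪x - y, w⟫ * σ + ‖w‖ ^ 2 * σ ^ 2 := by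
  rw [add_sub_right_comm, norm_add_sq_real, inner_smul_right, norm_smul, mul_pow,
    Real.norm_eq_abs, sq_abs]
  ring

lemma concaveParabola_add_smul (a : ℝ) (y : Space n) (s : ℝ) (x w : Space n) (t σ : ℝ) :
    concaveParabola a y s (x + σ • w, t) = concaveParabola a y s (x, t)
      + (-a * ⟪x - y, w⟫) * σ + (-(a / 2) * ‖w‖ ^ 2) * σ ^ 2 := by
  simp only [concaveParabola, norm_add_smul_sub_sq]
  ring

lemma hasDerivAt_concaveParabola (a : ℝ) (y : Space n) (s : ℝ) (x : Space n) (t : ℝ) :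
    HasDerivAt (fun τ : ℝ => concaveParabola a y s (x, τ)) a t := by
  simpa [concaveParabola] using
    (((hasDerivAt_id' t).sub_const s).const_mul a).const_add (-(a / 2) * ‖x - y‖ ^ 2)

lemma isStrictSubsolutionAt_concaveParabola_add {lam Lam δ a k d : ℝ} {y : Space n} {s : ℝ}
    {ψ : Space n × ℝ → ℝ} {x g : Space n} {t : ℝ} (hk : 0 ≤ a + k) (hkg : a + k + ‖g‖ ^ 2 < δ)
    (hψ : ∀ w, ∃ b₁ b₂ b₃ b₄, (∀ σ : ℝ, ψ (x + σ • w, t)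
      = ψ (x, t) + b₁ * σ + b₂ * σ ^ 2 + b₃ * σ ^ 3 + b₄ * σ ^ 4) ∧
      -k * ‖w‖ ^ 2 + ⟪g, w⟫ ^ 2 ≤ 2 * b₂)
    (hd : HasDerivAt (fun τ => ψ (x, τ)) d t) (hlt : a + d < lam * ‖g‖ ^ 2 - Lam * (a + k)) :
    IsStrictSubsolutionAt lam Lam δ (fun z => concaveParabola a y s z + ψ z) x t := by
  refine ⟨a + k, g, hk, hkg, fun w => ?_, ?_⟩
  · obtain ⟨b₁, b₂, b₃, b₄, hline, hb₂⟩ := hψ w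
    have hsum (σ : ℝ) : concaveParabola a y s (x + σ • w, t) + ψ (x + σ • w, t)
        = (concaveParabola a y s (x, t) + ψ (x, t)) + (-a * ⟪x - y, w⟫ + b₁) * σ
          + (-(a / 2) * ‖w‖ ^ 2 + b₂) * σ ^ 2 + b₃ * σ ^ 3 + b₄ * σ ^ 4 := by
      rw [concaveParabola_add_smul, hline]
      ring
    rw [funext hsum, iteratedDeriv_two_quartic]
    linarith
  · rwa [((hasDerivAt_concaveParabola a y s x t).fun_add hd).deriv]

end Parabolas

section Tube

variable {n : ℕ} {lam Lam δ : ℝ} {v Φ : Space n × ℝ → ℝ} {ρ t₁ t₂ : ℝ}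

/-- The tube of radius `ρ` about the curve `X` between the times `t₁` and `t₂`. -/
def tube (X : ℝ → Space n) (ρ t₁ t₂ : ℝ) : Set (Space n × ℝ) :=
  {z | z.2 ∈ Icc t₁ t₂ ∧ ‖z.1 - X z.2‖ ≤ ρ}

lemma IsEllipticSupersolution.comparison_tube (hv : IsEllipticSupersolution lam Lam δ v)
    {X : ℝ → Space n} (hX : Continuous X) (hQ : tube X ρ t₁ t₂ ⊆ Q₁ n) (hΦ : ContDiff ℝ ∞ Φ)
    (bottom : ∀ z ∈ tube X ρ t₁ t₂, z.2 = t₁ → Φ z ≤ v z)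
    (lateral : ∀ z ∈ tube X ρ t₁ t₂, ‖z.1 - X z.2‖ = ρ → Φ z ≤ v z)
    (interior : ∀ z ∈ tube X ρ t₁ t₂, IsStrictSubsolutionAt lam Lam δ Φ z.1 z.2) :
    ∀ z ∈ tube X ρ t₁ t₂, Φ z ≤ v z := by
  have hsub : tube X ρ t₁ t₂ ⊆ Metric.closedBall 0 1 ×ˢ Icc t₁ t₂ := fun z hz =>
    ⟨mem_closedBall_of_mem_Q₁ (hQ hz), hz.1⟩
  have hdist : Continuous fun z : Space n × ℝ => ‖z.1 - X z.2‖ :=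
    (continuous_fst.sub (hX.comp continuous_snd)).norm
  have hcompact : IsCompact (tube X ρ t₁ t₂) :=
    ((isCompact_closedBall _ _).prod isCompact_Icc).of_isClosed_subset
      ((isClosed_Icc.preimage continuous_snd).inter (isClosed_le hdist continuous_const)) hsub
  refine hv.comparison hcompact
    (hv.continuousOn.mono (hsub.trans (prod_mono_right (subset_univ _)))) hΦ fun z hz => ?_
  rcases hz.1.1.eq_or_lt with hbottom | hbottom
  · exact Or.inl (bottom z hz hbottom.symm)
  rcases hz.2.eq_or_lt with hlateral | hlateral
  · exact Or.inl (lateral z hz hlateral)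
  refine Or.inr ⟨hQ hz, ?_, interior z hz⟩
  filter_upwards [hdist.continuousAt.eventually_lt continuousAt_const hlateral,
    continuousAt_const.eventually_lt continuous_snd.continuousAt hbottom] with w hρ ht₁ hwz
  exact ⟨⟨ht₁.le, hwz.trans hz.1.2⟩, hρ.le⟩

lemma IsEllipticSupersolution.comparison_cylinder (hv : IsEllipticSupersolution lam Lam δ v)
    {x : Space n} (hQ : Metric.closedBall x ρ ×ˢ Icc t₁ t₂ ⊆ Q₁ n) (hΦ : ContDiff ℝ ∞ Φ)
    (bottom : ∀ z ∈ Q₁ n, ‖z.1 - x‖ ≤ ρ → z.2 = t₁ → Φ z ≤ v z)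
    (lateral : ∀ z ∈ Q₁ n, z.2 ∈ Icc t₁ t₂ → ‖z.1 - x‖ = ρ → Φ z ≤ v z)
    (interior : ∀ z : Space n × ℝ, IsStrictSubsolutionAt lam Lam δ Φ z.1 z.2)
    (ht : t₁ ≤ t₂) {ξ : Space n} (hξ : ‖ξ - x‖ ≤ ρ) : Φ (ξ, t₂) ≤ v (ξ, t₂) := by
  have hQ' : tube (fun _ => x) ρ t₁ t₂ ⊆ Q₁ n := fun z hz =>
    hQ ⟨mem_closedBall_iff_norm.2 hz.2, hz.1⟩
  exact hv.comparison_tube continuous_const hQ' hΦ (fun z hz => bottom z (hQ' hz) hz.2)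
    (fun z hz => lateral z (hQ' hz) hz.1) (fun z _ => interior z) (ξ, t₂) ⟨⟨ht, le_rfl⟩, hξ⟩

end Tube

section Gap

variable {n : ℕ} {lam Lam δ : ℝ} {v : Space n × ℝ → ℝ}

/-- Normalised ellipticity constants. -/
structure IsEllipticityPair (lam Lam : ℝ) : Prop where
  pos : 0 < lam
  le_one : lam ≤ 1
  one_le : 1 ≤ Lam

lemma IsEllipticityPair.Lam_pos (h : IsEllipticityPair lam Lam) : 0 < Lam :=
  one_pos.trans_le h.one_le

lemma IsEllipticityPair.one_le_div (h : IsEllipticityPair lam Lam) : 1 ≤ Lam / lam :=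
  (_root_.one_le_div h.pos).2 (h.le_one.trans h.one_le)

/-- A quadratic perturbation of a parabola; `ℓ` is meant to be affine. -/
noncomputable def quadraticBarrier (ℓ : Space n → ℝ) (e f A b : ℝ) (p : Space n) (t₀ : ℝ)
    (z : Space n × ℝ) : ℝ :=
  e * ℓ z.1 ^ 2 + f * ℓ z.1 - A * ‖z.1 - p‖ ^ 2 + b * (z.2 - t₀)

lemma contDiff_quadraticBarrier {ℓ : Space n → ℝ} (hℓ : ContDiff ℝ ∞ ℓ) (e f A b : ℝ)
    (p : Space n) (t₀ : ℝ) : ContDiff ℝ ∞ (quadraticBarrier ℓ e f A b p t₀) := by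
  have hℓ' : ContDiff ℝ ∞ fun z : Space n × ℝ => ℓ z.1 := hℓ.comp contDiff_fst
  unfold quadraticBarrier
  exact (((contDiff_const.mul (hℓ'.pow 2)).add (contDiff_const.mul hℓ')).sub
    (contDiff_const.mul ((contDiff_fst.sub contDiff_const).norm_sq ℝ))).add
    (contDiff_const.mul (contDiff_snd.sub contDiff_const))

lemma isStrictSubsolutionAt_add_quadraticBarrier {a : ℝ} {y : Space n} {s e f A b D t₀ : ℝ}
    {g q p : Space n} (he : 0 ≤ e) (hA : 0 ≤ a + 2 * A)
    (hδ : a + 2 * A + 2 * e * ‖g‖ ^ 2 < δ)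
    (hlt : a + b < lam * (2 * e * ‖g‖ ^ 2) - Lam * (a + 2 * A)) (z : Space n × ℝ) :
    IsStrictSubsolutionAt lam Lam δ
      (fun z => concaveParabola a y s z + quadraticBarrier (tilt g q D) e f A b p t₀ z)
      z.1 z.2 := by
  have hnorm : ‖√(2 * e) • g‖ ^ 2 = 2 * e * ‖g‖ ^ 2 := by
    rw [norm_smul, mul_pow, Real.norm_eq_abs, sq_abs, Real.sq_sqrt (by positivity)]
  refine isStrictSubsolutionAt_concaveParabola_add (k := 2 * A) (g := √(2 * e) • g) (d := b) hA
    (by rwa [hnorm]) (fun w => ?_) ?_ (by rwa [hnorm])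
  · refine ⟨2 * e * tilt g q D z.1 * ⟪g, w⟫ + f * ⟪g, w⟫ - 2 * A * ⟪z.1 - p, w⟫,
      e * ⟪g, w⟫ ^ 2 - A * ‖w‖ ^ 2, 0, 0, fun σ => ?_, le_of_eq ?_⟩
    · simp only [quadraticBarrier, tilt_add_smul, norm_add_smul_sub_sq]
      ring
    · rw [real_inner_smul_left, mul_pow, Real.sq_sqrt (by positivity)]
      ring
  · simpa [quadraticBarrier] using (((hasDerivAt_id' z.2).sub_const t₀).const_mul b).const_add
      (e * tilt g q D z.1 ^ 2 + f * tilt g q D z.1 - A * ‖z.1 - p‖ ^ 2)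

/-- The gap estimate at scale `r` uses the equation at parabolic distance `gapRadius * r`. -/
noncomputable def gapRadius (lam Lam : ℝ) : ℝ := 85 * Lam ^ 2 / lam

/-- The gradient constant in the gap estimate. -/
noncomputable def gapSlope (lam Lam : ℝ) : ℝ := 21 * Lam * gapRadius lam Lam / lam

lemma IsEllipticityPair.le_gapRadius (h : IsEllipticityPair lam Lam) :
    85 * Lam ≤ gapRadius lam Lam := by
  calc 85 * Lam ≤ 85 * Lam * (Lam / lam) :=
        le_mul_of_one_le_right (by linarith [h.Lam_pos]) h.one_le_div
    _ = gapRadius lam Lam := by rw [gapRadius]; ring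

lemma IsEllipticityPair.gapRadius_pos (h : IsEllipticityPair lam Lam) : 0 < gapRadius lam Lam := by
  linarith [h.le_gapRadius, h.Lam_pos]

lemma IsEllipticityPair.le_gapSlope (h : IsEllipticityPair lam Lam) :
    21 * gapRadius lam Lam ≤ gapSlope lam Lam := by
  calc 21 * gapRadius lam Lam ≤ 21 * gapRadius lam Lam * (Lam / lam) :=
        le_mul_of_one_le_right (by linarith [h.gapRadius_pos]) h.one_le_div
    _ = gapSlope lam Lam := by rw [gapSlope]; ring

lemma IsEllipticityPair.gapSlope_pos (h : IsEllipticityPair lam Lam) : 0 < gapSlope lam Lam := by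
  linarith [h.le_gapSlope, h.gapRadius_pos]

lemma IsEllipticityPair.gapSlope_lt (h : IsEllipticityPair lam Lam) :
    4 * Lam * gapSlope lam Lam < gapRadius lam Lam ^ 2 := by
  have hR := h.gapRadius_pos
  have hL := h.Lam_pos
  have hl := h.pos
  calc 4 * Lam * gapSlope lam Lam = 84 * (Lam ^ 2 / lam * gapRadius lam Lam) := by
        rw [gapSlope]; ring
    _ < 85 * (Lam ^ 2 / lam * gapRadius lam Lam) := by
        have : 0 < Lam ^ 2 / lam * gapRadius lam Lam := by positivity
        linarith
    _ = gapRadius lam Lam ^ 2 := by rw [sq (gapRadius lam Lam)]; nth_rw 2 [gapRadius]; ring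

variable {a r : ℝ} {y : Space n} {s : ℝ} {g : Space n} {D : ℝ} {x₁ x₂ : Space n} {t₁ t₂ : ℝ}

-- Below the tilted parabola one puts a bump which decays fast enough to be a strict subsolution,
-- and which a large `D` pushes below the untilted parabola at time `t₁`.
lemma IsEllipticSupersolution.drop_le (hv : IsEllipticSupersolution lam Lam δ v)
    (hLam : 1 ≤ Lam) (ha : 0 < a) (hr : 0 < r) (hδ : 4 * a < δ) (ht : t₁ ≤ t₂)
    (htr : t₂ ≤ t₁ + r ^ 2) (hx : ‖x₂ - x₁‖ ≤ r)
    (hQ : Metric.closedBall x₂ (3 * Lam * r) ×ˢ Icc t₁ t₂ ⊆ Q₁ n)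
    (h₁ : LiesBelow (concaveParabola a y s) v t₁)
    (h₂ : TouchesBelow (fun z => concaveParabola a y s z + tilt g x₁ D z.1) v x₂ t₂) :
    D ≤ 8 * Lam * ‖g‖ * r ∨ D ≤ 18 * Lam * a * r ^ 2 := by
  by_contra! hD
  have hL : 0 < Lam := one_pos.trans_le hLam
  have haL : a / Lam ≤ a := div_le_self ha.le hLam
  have key := hv.comparison_cylinder hQ (Φ := fun z => concaveParabola a y s z +
      quadraticBarrier (tilt g x₁ D) 0 1 (a / Lam) (-(9 / 2 * Lam * a)) x₂ (t₁ + 2 * r ^ 2) z)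
    ((contDiff_concaveParabola a y s).add (contDiff_quadraticBarrier (contDiff_tilt _ _ _) ..))
    (fun z hz hzx hzt => ?_) (fun z hz hzt hzx => ?_)
    (isStrictSubsolutionAt_add_quadraticBarrier le_rfl (by positivity) (by linarith) ?_) ht
    (ξ := x₂) (by simpa using by positivity)
  · have htouch := h₂.2
    simp only [quadraticBarrier, sub_self, norm_zero] at key htouch
    have : 0 < Lam * a * (t₁ + 2 * r ^ 2 - t₂) :=
      mul_pos (by positivity) (by linarith [pow_pos hr 2])
    linarith
  · refine le_trans ?_ (h₁.le_of_mem_Q₁ hz hzt.le)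
    have hzx₁ : ‖z.1 - x₁‖ ≤ 4 * Lam * r := by
      linarith [norm_sub_le_norm_sub_add_norm_sub z.1 x₂ x₁, le_mul_of_one_le_left hr.le hLam]
    have htilt := (tilt_le g x₁ D z.1).trans
      (sub_le_sub_right (mul_le_mul_of_nonneg_left hzx₁ (norm_nonneg g)) D)
    have : 0 ≤ a / Lam * ‖z.1 - x₂‖ ^ 2 := by positivity
    simp only [quadraticBarrier, hzt]
    linarith
  · refine le_trans ?_ (h₂.1.le_of_mem_Q₁ hz hzt.2)
    have hA : a / Lam * (3 * Lam * r) ^ 2 = 9 * Lam * a * r ^ 2 := by field_simp; norm_num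
    have := mul_nonneg (mul_pos hL ha).le (sub_nonneg.2 hzt.1)
    simp only [quadraticBarrier, hzx, hA]
    linarith
  · have hA : Lam * (a / Lam) = a := by field_simp
    have : a ≤ Lam * a := le_mul_of_one_le_left ha.le hLam
    linarith

lemma add_sq_div_add_half_le {p l u q : ℝ} (hq : 0 < q) (hl : |l| ≤ q) (hp : p ≤ u)
    (hpl : p + l ≤ u) : p + ((4 * q)⁻¹ * l ^ 2 + 1 / 2 * l) ≤ u := by
  have hsq : (4 * q)⁻¹ * l ^ 2 ≤ |l| / 4 := by
    rw [inv_mul_le_iff₀ (by positivity), ← sq_abs]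
    nlinarith [abs_nonneg l]
  rcases abs_cases l with ⟨h, -⟩ | ⟨h, -⟩ <;> rw [h] at hsq <;> linarith

lemma abs_tilt_le {ρ : ℝ} {x : Space n} (hx : ‖x - x₁‖ ≤ ρ) (hD₀ : 0 ≤ D) (hD : D ≤ ‖g‖ * ρ) :
    |tilt g x₁ D x| ≤ 2 * (‖g‖ * ρ) := by
  have hinner : |⟪g, x - x₁⟫| ≤ ‖g‖ * ρ := (abs_real_inner_le_norm _ _).trans (by gcongr)
  rw [abs_le] at hinner ⊢
  constructor <;> rw [tilt] <;> linarith

-- `max (P, P + ℓ)` has a sharp crease near `x₁`; its quadratic smoothing is a strict subsolution.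
lemma IsEllipticSupersolution.not_touchesBelow_of_crease
    (hv : IsEllipticSupersolution lam Lam δ v) (hell : IsEllipticityPair lam Lam) (ha : 0 < a)
    (hr : 0 < r) (hδ : 14 * Lam / lam * a < δ)
    (hQ : Metric.closedBall x₁ (gapRadius lam Lam * r) ×ˢ
      Icc (t₁ - (gapRadius lam Lam * r) ^ 2) t₁ ⊆ Q₁ n)
    (htilt : LiesBelow (fun z => concaveParabola a y s z + tilt g x₁ D z.1) v t₁)
    (hg : ‖g‖ = gapSlope lam Lam * a * r) (hD₀ : 0 ≤ D)
    (hD : D ≤ 8 * Lam * (gapSlope lam Lam * a * r) * r) :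
    ¬TouchesBelow (concaveParabola a y s) v x₁ t₁ := by
  intro htouch
  have hl := hell.pos
  have hL := hell.Lam_pos
  have hR₀ := hell.gapRadius_pos
  have hC₀ := hell.gapSlope_pos
  set R := gapRadius lam Lam
  set C := gapSlope lam Lam
  set q : ℝ := 2 * (‖g‖ * (R * r)) with hq
  have hq₀ : 0 < q := by rw [hq, hg]; positivity
  have hDR : D ≤ ‖g‖ * (R * r) := by
    have : 8 * Lam * (C * a * r ^ 2) ≤ R * (C * a * r ^ 2) := by
      gcongr
      linarith [hell.le_gapRadius]
    rw [hg]
    linarith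
  have hsmooth (z : Space n × ℝ) (hz : z ∈ Q₁ n) (hzx : ‖z.1 - x₁‖ ≤ R * r) (hzt : z.2 ≤ t₁) :
      concaveParabola a y s z + ((4 * q)⁻¹ * tilt g x₁ D z.1 ^ 2 + 1 / 2 * tilt g x₁ D z.1)
        ≤ v z :=
    add_sq_div_add_half_le hq₀ (abs_tilt_le hzx hD₀ hDR) (htouch.1.le_of_mem_Q₁ hz hzt)
      (htilt.le_of_mem_Q₁ hz hzt)
  have hcurv : 2 * (4 * q)⁻¹ * ‖g‖ ^ 2 = 21 / 4 * (Lam / lam * a) := by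
    have hCR : C * lam = 21 * Lam * R := div_mul_cancel₀ _ hl.ne'
    rw [hq, hg]
    field_simp
    linarith
  have haL : a ≤ Lam * a := le_mul_of_one_le_left ha.le hell.one_le
  have haLl : a ≤ Lam / lam * a := le_mul_of_one_le_left ha.le hell.one_le_div
  have key := hv.comparison_cylinder hQ (Φ := fun z => concaveParabola a y s z +
      quadraticBarrier (tilt g x₁ D) (4 * q)⁻¹ (1 / 2) a a x₁ (t₁ - (R * r) ^ 2) z)
    ((contDiff_concaveParabola a y s).add (contDiff_quadraticBarrier (contDiff_tilt _ _ _) ..))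
    (fun z hz hzx hzt => ?_) (fun z hz hzt hzx => ?_)
    (isStrictSubsolutionAt_add_quadraticBarrier (by positivity) (by positivity) ?_ ?_)
    (by linarith [sq_nonneg (R * r)]) (ξ := x₁) (by simpa using by positivity)
  · rw [← htouch.2] at key
    have hRC : 4 * Lam * C * (a * r ^ 2) < R ^ 2 * (a * r ^ 2) := by
      gcongr
      exact hell.gapSlope_lt
    have : 0 ≤ (4 * q)⁻¹ * D ^ 2 := by positivity
    simp only [quadraticBarrier, tilt, sub_self, norm_zero, inner_zero_right] at key
    linarith
  · refine le_trans ?_ (hsmooth z hz hzx (by linarith [sq_nonneg (R * r)]))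
    have : 0 ≤ a * ‖z.1 - x₁‖ ^ 2 := by positivity
    simp only [quadraticBarrier, hzt]
    linarith
  · refine le_trans ?_ (hsmooth z hz hzx.le hzt.2)
    have := mul_le_mul_of_nonneg_left hzt.2 ha.le
    simp only [quadraticBarrier, hzx]
    linarith
  · rw [hcurv]
    linarith [show 14 * Lam / lam * a = 14 * (Lam / lam * a) by ring]
  · rw [hcurv]
    have : lam * (21 / 4 * (Lam / lam * a)) = 21 / 4 * (Lam * a) := by field_simp
    linarith [mul_pos hL ha]

lemma TouchesBelow.tilt_nonneg {P : Space n × ℝ → ℝ} (h₁ : TouchesBelow P v x₁ t₁)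
    (hx₁ : x₁ ∈ Metric.closedBall (0 : Space n) 1)
    (h₂ : LiesBelow (fun z => P z + tilt g x₁ D z.1) v t₁) : 0 ≤ D := by
  have hle := h₂ x₁ hx₁ t₁ le_rfl
  rw [← h₁.2] at hle
  simp only [tilt, sub_self, inner_zero_right] at hle
  linarith

lemma LiesBelow.tilt_smul {P : Space n × ℝ → ℝ} {t κ : ℝ} (h₁ : LiesBelow P v t)
    (h₂ : LiesBelow (fun z => P z + tilt g x₁ D z.1) v t) (hκ₀ : 0 ≤ κ) (hκ₁ : κ ≤ 1) :
    LiesBelow (fun z => P z + tilt (κ • g) x₁ (κ * D) z.1) v t := fun ξ hξ τ hτ => by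
  have hle := add_le_add (mul_le_mul_of_nonneg_left (h₁ ξ hξ τ hτ) (sub_nonneg.2 hκ₁))
    (mul_le_mul_of_nonneg_left (h₂ ξ hξ τ hτ) hκ₀)
  simp only [ParabolicContact.tilt_smul] at hle ⊢
  linarith

-- Too steep a tilt could be scaled down to one of slope exactly `gapSlope * a * r`, which
-- `not_touchesBelow_of_crease` excludes.
lemma IsEllipticSupersolution.tilt_bounds (hv : IsEllipticSupersolution lam Lam δ v)
    (hell : IsEllipticityPair lam Lam) (ha : 0 < a) (hr : 0 < r) (hδ : 14 * Lam / lam * a < δ)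
    (ht : t₁ ≤ t₂) (htr : t₂ ≤ t₁ + r ^ 2) (hx : ‖x₂ - x₁‖ ≤ r)
    (hQ : Metric.closedBall x₁ (gapRadius lam Lam * r) ×ˢ
      Icc (t₁ - (gapRadius lam Lam * r) ^ 2) t₂ ⊆ Q₁ n)
    (h₁ : TouchesBelow (concaveParabola a y s) v x₁ t₁)
    (h₂ : TouchesBelow (fun z => concaveParabola a y s z + tilt g x₁ D z.1) v x₂ t₂) :
    ‖g‖ ≤ gapSlope lam Lam * a * r ∧ 0 ≤ D ∧ D ≤ 8 * Lam * (gapSlope lam Lam * a * r) * r := by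
  have hL := hell.Lam_pos
  have hR₀ := hell.gapRadius_pos
  have hC₀ := hell.gapSlope_pos
  have hR := hell.le_gapRadius
  have haLl : a ≤ Lam / lam * a := le_mul_of_one_le_left ha.le hell.one_le_div
  have hRr : 0 ≤ (gapRadius lam Lam * r) ^ 2 := sq_nonneg _
  have hD₀ : 0 ≤ D := h₁.tilt_nonneg (mem_closedBall_of_mem_Q₁ (z := (x₁, t₁)) <|
    hQ ⟨Metric.mem_closedBall_self (by positivity), by linarith, ht⟩) (h₂.1.mono ht)
  have hdrop := hv.drop_le hell.one_le ha hr
    (by linarith [show 14 * Lam / lam * a = 14 * (Lam / lam * a) by ring]) ht htr hx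
    (Subset.trans (prod_mono (Metric.closedBall_subset_closedBall' ?_)
      (Icc_subset_Icc_left (by linarith))) hQ) h₁.1 h₂
  · have hsmall : 18 * Lam * a * r ^ 2 ≤ 8 * Lam * (gapSlope lam Lam * a * r) * r := by
      have : (18 * (Lam * a * r ^ 2)) ≤ 8 * gapSlope lam Lam * (Lam * a * r ^ 2) := by
        gcongr
        linarith [hell.le_gapSlope, hell.one_le]
      linarith
    rcases le_or_gt ‖g‖ (gapSlope lam Lam * a * r) with hg | hg
    · exact ⟨hg, hD₀, hdrop.elim (fun h => h.trans (by gcongr)) hsmall.trans'⟩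
    · have hg₀ : 0 < ‖g‖ := lt_trans (by positivity) hg
      set κ := gapSlope lam Lam * a * r / ‖g‖
      have hκg : κ * ‖g‖ = gapSlope lam Lam * a * r := div_mul_cancel₀ _ hg₀.ne'
      have hκ₀ : 0 ≤ κ := by positivity
      have hκ₁ : κ ≤ 1 := (div_le_one hg₀).2 hg.le
      refine absurd h₁ (hv.not_touchesBelow_of_crease hell ha hr hδ
        ((prod_mono_right (Icc_subset_Icc_right ht)).trans hQ)
        (h₁.1.tilt_smul (h₂.1.mono ht) hκ₀ hκ₁) ?_ (by positivity) ?_)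
      · rw [norm_smul, Real.norm_of_nonneg hκ₀, hκg]
      · rcases hdrop with h | h
        · calc κ * D ≤ κ * (8 * Lam * ‖g‖ * r) := by gcongr
            _ = 8 * Lam * (κ * ‖g‖) * r := by ring
            _ = 8 * Lam * (gapSlope lam Lam * a * r) * r := by rw [hκg]
        · exact (mul_le_of_le_one_left hD₀ hκ₁).trans (h.trans hsmall)
  · rw [dist_eq_norm]
    have : (3 * Lam + 1) * r ≤ gapRadius lam Lam * r := by
      gcongr
      linarith [hell.one_le]
    linarith

end Gap

section Barrier

variable {n : ℕ} {lam Lam δ : ℝ} {v : Space n × ℝ → ℝ}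

/-- The decay rate of the moving barrier. -/
noncomputable def barrierRate (lam Lam : ℝ) : ℝ := 49 * Lam ^ 2 / (4 * lam)

/-- The constant in the backward growth estimate `exists_le_concaveParabola_add`. -/
noncomputable def growthConst (lam Lam : ℝ) : ℝ :=
  Lam / lam * Real.exp (600 * barrierRate lam Lam)

/-- The height at time `τ` of the moving barrier of radius `ρ`. -/
noncomputable def barrierHeight (A μ ρ t₀ τ : ℝ) : ℝ := A * Real.exp (-(μ / ρ ^ 2) * (τ - t₀))

/-- The line through `c` at time `t₀` with velocity `V`, which is the axis of the moving barrier. -/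
def axis (c V : Space n) (t₀ τ : ℝ) : Space n := c + (τ - t₀) • V

/-- A bump of radius `ρ` which travels along `axis c V t₀` and decays exponentially. -/
noncomputable def movingBarrier (A μ ρ : ℝ) (c V : Space n) (t₀ : ℝ) (z : Space n × ℝ) : ℝ :=
  barrierHeight A μ ρ t₀ z.2 * (1 - ‖z.1 - axis c V t₀ z.2‖ ^ 2 / ρ ^ 2) ^ 2

lemma IsEllipticityPair.barrierRate_pos (h : IsEllipticityPair lam Lam) :
    0 < barrierRate lam Lam := by
  have := h.pos
  have := h.Lam_pos
  unfold barrierRate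
  positivity

lemma IsEllipticityPair.one_le_growthConst (h : IsEllipticityPair lam Lam) :
    1 ≤ growthConst lam Lam :=
  one_le_mul_of_one_le_of_one_le h.one_le_div
    (Real.one_le_exp (mul_nonneg (by norm_num) h.barrierRate_pos.le))

lemma hasDerivAt_barrierHeight (A μ ρ t₀ τ : ℝ) :
    HasDerivAt (barrierHeight A μ ρ t₀) (-(μ / ρ ^ 2) * barrierHeight A μ ρ t₀ τ) τ := by
  refine ((((hasDerivAt_id' τ).sub_const t₀).const_mul (-(μ / ρ ^ 2))).exp.const_mul A).congr_deriv
    ?_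
  rw [barrierHeight]
  ring

lemma barrierHeight_le {A μ ρ t₀ τ : ℝ} (hA : 0 ≤ A) (hμ : 0 ≤ μ) (hτ : t₀ ≤ τ) :
    barrierHeight A μ ρ t₀ τ ≤ A := by
  refine mul_le_of_le_one_right hA (Real.exp_le_one_iff.2 ?_)
  have : 0 ≤ μ / ρ ^ 2 * (τ - t₀) := mul_nonneg (by positivity) (sub_nonneg.2 hτ)
  linarith

lemma le_barrierHeight {A μ ρ t₀ τ T : ℝ} (hA : 0 ≤ A) (hμ : 0 ≤ μ) (hρ : 0 < ρ)
    (hτ : τ - t₀ ≤ T * ρ ^ 2) : A * Real.exp (-(T * μ)) ≤ barrierHeight A μ ρ t₀ τ := by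
  have : μ / ρ ^ 2 * (τ - t₀) ≤ T * μ := by
    rw [div_mul_eq_mul_div, div_le_iff₀ (by positivity)]
    linarith [mul_le_mul_of_nonneg_left hτ hμ]
  exact mul_le_mul_of_nonneg_left (Real.exp_le_exp.2 (by linarith)) hA

lemma contDiff_axis (c V : Space n) (t₀ : ℝ) : ContDiff ℝ ∞ (axis c V t₀) :=
  contDiff_const.add ((contDiff_id.sub contDiff_const).smul contDiff_const)

lemma hasDerivAt_axis (c V : Space n) (t₀ τ : ℝ) : HasDerivAt (axis c V t₀) V τ :=
  ((((hasDerivAt_id' τ).sub_const t₀).smul_const V).const_add c).congr_deriv (one_smul ℝ V)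

lemma contDiff_movingBarrier (A μ ρ : ℝ) (c V : Space n) (t₀ : ℝ) :
    ContDiff ℝ ∞ (movingBarrier A μ ρ c V t₀) := by
  have hheight : ContDiff ℝ ∞ (barrierHeight A μ ρ t₀) := by
    unfold barrierHeight
    fun_prop
  exact (hheight.comp contDiff_snd).mul ((contDiff_const.sub (((contDiff_fst.sub
    ((contDiff_axis c V t₀).comp contDiff_snd)).norm_sq ℝ).div_const _)).pow 2)

lemma movingBarrier_add_smul (A μ : ℝ) {ρ : ℝ} (hρ : 0 < ρ) (c V : Space n) (t₀ : ℝ)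
    (x w : Space n) (t σ : ℝ) :
    let e := barrierHeight A μ ρ t₀ t
    let η := x - axis c V t₀ t
    let p := ‖η‖ ^ 2 / ρ ^ 2
    movingBarrier A μ ρ c V t₀ (x + σ • w, t) = movingBarrier A μ ρ c V t₀ (x, t)
      + -(e * (2 * (1 - p) * (2 * ⟪η, w⟫ / ρ ^ 2))) * σ
      + e * (-2 * (1 - p) * (‖w‖ ^ 2 / ρ ^ 2) + 4 * ⟪η, w⟫ ^ 2 / ρ ^ 4) * σ ^ 2
      + e * (4 * ⟪η, w⟫ * ‖w‖ ^ 2 / ρ ^ 4) * σ ^ 3 + e * (‖w‖ ^ 4 / ρ ^ 4) * σ ^ 4 := by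
  simp only [movingBarrier, norm_add_smul_sub_sq]
  field_simp
  ring

lemma hasDerivAt_movingBarrier (A μ ρ : ℝ) (c V : Space n) (t₀ : ℝ) (x : Space n) (t : ℝ) :
    let E := barrierHeight A μ ρ t₀ t / ρ ^ 2
    let q := 1 - ‖x - axis c V t₀ t‖ ^ 2 / ρ ^ 2
    HasDerivAt (fun τ => movingBarrier A μ ρ c V t₀ (x, τ))
      (E * (-(μ * q ^ 2) + 4 * q * ⟪x - axis c V t₀ t, V⟫)) t := by
  have hnorm : HasDerivAt (fun τ => ‖x - axis c V t₀ τ‖ ^ 2) (2 * ⟪x - axis c V t₀ t, -V⟫) t :=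
    ((hasDerivAt_axis c V t₀ t).const_sub x).norm_sq
  refine ((hasDerivAt_barrierHeight A μ ρ t₀ t).fun_mul
    (((hnorm.div_const (ρ ^ 2)).const_sub 1).fun_pow 2)).congr_deriv ?_
  rw [inner_neg_right]
  push_cast
  ring

-- `q` is the profile `1 - |η|²` of the barrier and `w` its speed in the direction of `η`.
lemma IsEllipticityPair.barrier_profile (h : IsEllipticityPair lam Lam) {q w : ℝ} (hq : 0 ≤ q)
    (hw : w ≤ 2 / 5) :
    4 * lam ≤ 8 * lam * (1 - q) - 4 * Lam * q + barrierRate lam Lam * q ^ 2 - 4 * q * w := by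
  have hlam := h.pos
  have hqw : q * w ≤ q * (2 / 5) := mul_le_mul_of_nonneg_left hw hq
  have hLq : q ≤ Lam * q := le_mul_of_one_le_left hq h.one_le
  have hlamq : lam * q ≤ q := mul_le_of_le_one_left hq h.le_one
  have hsq : 4 * lam + barrierRate lam Lam * q ^ 2 - 14 * Lam * q
      = (4 * lam - 7 * Lam * q) ^ 2 / (4 * lam) := by
    unfold barrierRate
    field_simp
    ring
  have : 0 ≤ (4 * lam - 7 * Lam * q) ^ 2 / (4 * lam) := by positivity
  linarith

variable {a ρ A : ℝ} {y : Space n} {s : ℝ} {c V : Space n} {t₀ t₁ : ℝ}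

lemma IsEllipticityPair.isStrictSubsolutionAt_add_movingBarrier (h : IsEllipticityPair lam Lam)
    (ha : 0 < a) (hρ : 0 < ρ) (hV : ‖V‖ * ρ ≤ 2 / 5) {x : Space n} {t : ℝ}
    (hx : ‖x - axis c V t₀ t‖ ≤ ρ)
    (hlow : Lam * a ≤ lam * (barrierHeight A (barrierRate lam Lam) ρ t₀ t / ρ ^ 2))
    (hδ : a + 12 * (barrierHeight A (barrierRate lam Lam) ρ t₀ t / ρ ^ 2) < δ) :
    IsStrictSubsolutionAt lam Lam δ
      (fun z => concaveParabola a y s z + movingBarrier A (barrierRate lam Lam) ρ c V t₀ z)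
      x t := by
  set μ := barrierRate lam Lam
  set e := barrierHeight A μ ρ t₀ t with he
  set η := x - axis c V t₀ t with hη
  set p := ‖η‖ ^ 2 / ρ ^ 2 with hp
  set E := e / ρ ^ 2 with hE
  have hlam := h.pos
  have hLa : a ≤ Lam * a := le_mul_of_one_le_left ha.le h.one_le
  have hE₀ : 0 < E := pos_of_mul_pos_right (lt_of_lt_of_le (by linarith) hlow) hlam.le
  have he₀ : 0 < e := by rwa [hE, div_pos_iff_of_pos_right (by positivity)] at hE₀
  have hp₁ : p ≤ 1 := (div_le_one (by positivity)).2 (pow_le_pow_left₀ (norm_nonneg _) hx 2)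
  have hq₀ : 0 ≤ (1 - p) * E := mul_nonneg (sub_nonneg.2 hp₁) hE₀.le
  have hg : ‖(√(8 * e) / ρ ^ 2) • η‖ ^ 2 = 8 * E * p := by
    rw [norm_smul, mul_pow, Real.norm_eq_abs, sq_abs, div_pow, Real.sq_sqrt (by positivity), hp, hE]
    field_simp
  refine isStrictSubsolutionAt_concaveParabola_add (k := 4 * (1 - p) * E)
    (g := (√(8 * e) / ρ ^ 2) • η) (by linarith) ?_
    (fun w => ⟨_, _, _, _, movingBarrier_add_smul A μ hρ c V t₀ x w t, le_of_eq ?_⟩)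
    (hasDerivAt_movingBarrier A μ ρ c V t₀ x t) ?_
  · rw [hg]
    linarith [mul_le_of_le_one_left hE₀.le hp₁]
  · rw [real_inner_smul_left, mul_pow, div_pow, Real.sq_sqrt (by positivity)]
    simp only [hE, hp, hη, he]
    field_simp
    ring
  · have hinner : ⟪η, V⟫ ≤ 2 / 5 := (real_inner_le_norm _ _).trans <| by
      linarith [mul_le_mul_of_nonneg_right hx (norm_nonneg V)]
    have hprofile := mul_le_mul_of_nonneg_left
      (h.barrier_profile (sub_nonneg.2 hp₁) hinner) hE₀.le
    rw [hg]
    linarith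

lemma IsEllipticityPair.isStrictSubsolutionAt_of_mem_tube (h : IsEllipticityPair lam Lam)
    (ha : 0 < a) (hρ : 0 < ρ) (hδ : 13 * growthConst lam Lam * a < δ) (hV : ‖V‖ * ρ ≤ 2 / 5)
    (hT : t₁ - t₀ ≤ 600 * ρ ^ 2) {z : Space n × ℝ} (hz : z ∈ tube (axis c V t₀) ρ t₀ t₁) :
    IsStrictSubsolutionAt lam Lam δ (fun z => concaveParabola a y s z +
      movingBarrier (growthConst lam Lam * a * ρ ^ 2) (barrierRate lam Lam) ρ c V t₀ z)
      z.1 z.2 := by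
  set μ := barrierRate lam Lam with hμ
  set A := growthConst lam Lam * a * ρ ^ 2 with hA
  have hlam := h.pos
  have hG := h.one_le_growthConst
  have hA₀ : 0 ≤ A := by positivity
  have hlow : Lam / lam * a * ρ ^ 2 ≤ barrierHeight A μ ρ t₀ z.2 := by
    refine le_trans (le_of_eq ?_) (le_barrierHeight hA₀ h.barrierRate_pos.le hρ
      (by linarith [hz.1.2] : z.2 - t₀ ≤ 600 * ρ ^ 2))
    rw [hA, growthConst, ← hμ, Real.exp_neg]
    field_simp
  have hhigh : barrierHeight A μ ρ t₀ z.2 / ρ ^ 2 ≤ growthConst lam Lam * a :=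
    (div_le_iff₀ (by positivity)).2 (barrierHeight_le hA₀ h.barrierRate_pos.le hz.1.1)
  refine h.isStrictSubsolutionAt_add_movingBarrier ha hρ hV hz.2 ?_
    (by linarith [le_mul_of_one_le_left ha.le hG])
  calc Lam * a = lam * (Lam / lam * a) := by field_simp
    _ ≤ lam * (barrierHeight A μ ρ t₀ z.2 / ρ ^ 2) := by
      gcongr
      rwa [le_div_iff₀ (by positivity)]

lemma IsEllipticSupersolution.exists_le_concaveParabola_add
    (hv : IsEllipticSupersolution lam Lam δ v) (hell : IsEllipticityPair lam Lam) (ha : 0 < a)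
    (hρ : 0 < ρ) (hδ : 13 * growthConst lam Lam * a < δ) (hV : ‖V‖ * ρ ≤ 2 / 5) (ht : t₀ ≤ t₁)
    (hT : t₁ - t₀ ≤ 600 * ρ ^ 2) (hQ : tube (axis c V t₀) ρ t₀ t₁ ⊆ Q₁ n) {x₁ : Space n}
    (hx : ‖x₁ - axis c V t₀ t₁‖ < ρ) (h₁ : TouchesBelow (concaveParabola a y s) v x₁ t₁) :
    ∃ x₂, ‖x₂ - c‖ ≤ ρ ∧
      v (x₂, t₀) ≤ concaveParabola a y s (x₂, t₀) + growthConst lam Lam * a * ρ ^ 2 := by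
  by_contra! hcon
  set μ := barrierRate lam Lam
  set A := growthConst lam Lam * a * ρ ^ 2
  have hG := hell.one_le_growthConst
  have hA₀ : 0 < A := by positivity
  have key := hv.comparison_tube (contDiff_axis c V t₀).continuous hQ
    (Φ := fun z => concaveParabola a y s z + movingBarrier A μ ρ c V t₀ z)
    ((contDiff_concaveParabola a y s).add (contDiff_movingBarrier A μ ρ c V t₀))
    (fun z hz hzt => ?_) (fun z hz hzρ => ?_)
    (fun z hz => hell.isStrictSubsolutionAt_of_mem_tube ha hρ hδ hV hT hz)
    (x₁, t₁) ⟨⟨ht, le_rfl⟩, hx.le⟩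
  · have hp : ‖x₁ - axis c V t₀ t₁‖ ^ 2 / ρ ^ 2 < 1 :=
      (div_lt_one (by positivity)).2 (pow_lt_pow_left₀ hx (norm_nonneg _) two_ne_zero)
    have : 0 < movingBarrier A μ ρ c V t₀ (x₁, t₁) :=
      mul_pos (mul_pos hA₀ (Real.exp_pos _)) (pow_pos (sub_pos.2 hp) 2)
    linarith [h₁.2]
  · obtain ⟨ξ, τ⟩ := z
    obtain rfl : τ = t₀ := hzt
    have hξ : ‖ξ - c‖ ≤ ρ := by simpa [axis] using hz.2
    refine le_trans ?_ (hcon ξ hξ).le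
    have hp : ‖ξ - c‖ ^ 2 / ρ ^ 2 ≤ 1 :=
      (div_le_one (by positivity)).2 (pow_le_pow_left₀ (norm_nonneg _) hξ 2)
    have hp₀ : 0 ≤ ‖ξ - c‖ ^ 2 / ρ ^ 2 := by positivity
    have : movingBarrier A μ ρ c V τ (ξ, τ) ≤ A := by
      simpa [movingBarrier, barrierHeight, axis] using
        mul_le_of_le_one_right hA₀.le (pow_le_one₀ (sub_nonneg.2 hp) (by linarith))
    linarith
  · refine le_trans (le_of_eq ?_) (h₁.1.le_of_mem_Q₁ (hQ hz) hz.1.2)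
    simp [movingBarrier, hzρ, hρ.ne']

end Barrier

section Sliding

variable {n : ℕ} {φ v : Space n × ℝ → ℝ}

lemma liesBelow_of_forall_ball (hc : ContinuousOn v (Metric.closedBall 0 1 ×ˢ univ))
    (hφ : Continuous φ) {t : ℝ}
    (h : ∀ ξ ∈ Metric.ball (0 : Space n) 1, ∀ τ < t, φ (ξ, τ) ≤ v (ξ, τ)) :
    LiesBelow φ v t := by
  intro ξ hξ τ hτ
  have hcl : closure (Metric.ball (0 : Space n) 1 ×ˢ Iio t)
      = Metric.closedBall (0 : Space n) 1 ×ˢ Iic t := by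
    rw [closure_prod_eq, closure_ball _ one_ne_zero, closure_Iio]
  have hvc : ContinuousOn v (closure (Metric.ball (0 : Space n) 1 ×ˢ Iio t)) :=
    hcl ▸ hc.mono (prod_mono_right (subset_univ _))
  exact le_on_closure (fun z hz => h z.1 hz.1 z.2 hz.2) hφ.continuousOn hvc (hcl ▸ ⟨hξ, hτ⟩)

lemma exists_touchesBelow_add (hc : ContinuousOn v (Metric.closedBall 0 1 ×ˢ univ))
    {E : Space n × ℝ → ℝ} (hφ : Continuous φ) (hE : Continuous E) {s t : ℝ} (hst : s ≤ t)
    (hbelow : LiesBelow φ v t) (hE₀ : ∀ ξ, ∀ τ ≤ s, E (ξ, τ) ≤ 0) {x : Space n}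
    (hx : x ∈ Metric.closedBall (0 : Space n) 1) (hcross : v (x, t) ≤ φ (x, t) + E (x, t)) :
    ∃ z : Space n × ℝ, z.2 ∈ Icc s t ∧ 0 ≤ E z ∧
      TouchesBelow (fun w => φ w + E w) v z.1 z.2 := by
  set K : Set (Space n × ℝ) := Metric.closedBall 0 1 ×ˢ Icc s t
  have hK : IsCompact K := (isCompact_closedBall _ _).prod isCompact_Icc
  have hsumc : Continuous fun w => φ w + E w := hφ.add hE
  have hcrossing : IsCompact {z | z ∈ K ∧ v z ≤ φ z + E z} :=
    hK.of_isClosed_subset (hK.isClosed.isClosed_le (hc.mono (prod_mono_right (subset_univ _)))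
      hsumc.continuousOn) fun z hz => hz.1
  obtain ⟨z, ⟨⟨hz₁, hz₂⟩, hzv⟩, hfirst⟩ := hcrossing.exists_isMinOn
    ⟨(x, t), ⟨hx, hst, le_rfl⟩, hcross⟩ continuous_snd.continuousOn
  have hsum : LiesBelow (fun w => φ w + E w) v z.2 := by
    refine liesBelow_of_forall_ball hc hsumc fun ξ hξ τ hτ => ?_
    have hξ' := Metric.ball_subset_closedBall hξ
    rcases le_total τ s with h | h
    · linarith [hbelow ξ hξ' τ (hτ.le.trans hz₂.2), hE₀ ξ τ h]
    · by_contra! hlt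
      exact hτ.not_ge (isMinOn_iff.1 hfirst (ξ, τ) ⟨⟨hξ', h, hτ.le.trans hz₂.2⟩, hlt.le⟩)
  have hle : φ z ≤ v z := hbelow z.1 hz₁ z.2 hz₂.2
  exact ⟨z, hz₂, by linarith, hsum, (hsum z.1 hz₁ z.2 le_rfl).antisymm hzv⟩

end Sliding

section Vertices

variable {n : ℕ}

/-- The time at which the concave parabolas with vertex `e` vanish above `x`. For fixed `x`, the map
`e ↦ (e.1, zeroTime x e)` is a shear. -/
noncomputable def zeroTime (x : Space n) (e : Space n × ℝ) : ℝ := e.2 + ‖x - e.1‖ ^ 2 / 2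

/-- The vertex of the sum of the concave parabolas of openings `a`, `b` and vertices `e`, `e'`. -/
noncomputable def sumVertex (a b : ℝ) (e e' : Space n × ℝ) : Space n × ℝ :=
  ((a + b)⁻¹ • (a • e.1 + b • e'.1),
    (a * e.2 + b * e'.2) / (a + b) + a * b / (2 * (a + b) ^ 2) * ‖e.1 - e'.1‖ ^ 2)

lemma concaveParabola_eq_mul_zeroTime (b : ℝ) (e z : Space n × ℝ) :
    concaveParabola b e.1 e.2 z = b * (z.2 - zeroTime z.1 e) := by
  rw [concaveParabola, zeroTime]
  ring

lemma zeroTime_sub_zeroTime (e e' : Space n × ℝ) (x ξ : Space n) :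
    zeroTime ξ e - zeroTime ξ e' = ⟪e'.1 - e.1, ξ - x⟫ + (zeroTime x e - zeroTime x e') := by
  have hnorm (y : Space n) : ‖ξ - y‖ ^ 2 = ‖ξ - x‖ ^ 2 + 2 * ⟪ξ - x, x - y⟫ + ‖x - y‖ ^ 2 := by
    rw [← norm_add_sq_real, sub_add_sub_cancel]
  have hdiff : ⟪e'.1 - e.1, ξ - x⟫ = ⟪ξ - x, x - e.1⟫ - ⟪ξ - x, x - e'.1⟫ := by
    rw [← inner_sub_right, sub_sub_sub_cancel_left, real_inner_comm]
  simp only [zeroTime, hnorm e.1, hnorm e'.1, hdiff]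
  ring

lemma concaveParabola_eq_add_tilt (b : ℝ) (e e' z : Space n × ℝ) (x : Space n) :
    concaveParabola b e'.1 e'.2 z = concaveParabola b e.1 e.2 z
      + tilt (b • (e'.1 - e.1)) x (b * (zeroTime x e' - zeroTime x e)) z.1 := by
  rw [tilt_smul, tilt, concaveParabola_eq_mul_zeroTime, concaveParabola_eq_mul_zeroTime]
  linear_combination b * zeroTime_sub_zeroTime e e' x z.1

lemma mul_norm_sub_sq_add {a b : ℝ} (hab : a + b ≠ 0) (x y y' : Space n) :
    a * ‖x - y‖ ^ 2 + b * ‖x - y'‖ ^ 2 =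
      (a + b) * ‖x - (a + b)⁻¹ • (a • y + b • y')‖ ^ 2 + a * b / (a + b) * ‖y - y'‖ ^ 2 := by
  have hmean : (a + b) • (x - (a + b)⁻¹ • (a • y + b • y')) = a • (x - y) + b • (x - y') := by
    rw [smul_sub, smul_inv_smul₀ hab]
    module
  have hmean_sq := congrArg (fun w => ‖w‖ ^ 2) hmean
  simp only [norm_add_sq_real, norm_smul, mul_pow, Real.norm_eq_abs, sq_abs,
    real_inner_smul_left, real_inner_smul_right] at hmean_sq
  have hdiff : ‖y - y'‖ ^ 2 = ‖x - y'‖ ^ 2 - 2 * ⟪x - y', x - y⟫ + ‖x - y‖ ^ 2 := by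
    rw [← norm_sub_sq_real, sub_sub_sub_cancel_left]
  rw [hdiff, real_inner_comm]
  generalize (a + b)⁻¹ • (a • y + b • y') = m at hmean_sq ⊢
  field_simp
  linear_combination -hmean_sq

lemma concaveParabola_add {a b : ℝ} (hab : a + b ≠ 0) (e e' z : Space n × ℝ) :
    concaveParabola a e.1 e.2 z + concaveParabola b e'.1 e'.2 z =
      concaveParabola (a + b) (sumVertex a b e e').1 (sumVertex a b e e').2 z := by
  have h := mul_norm_sub_sq_add hab z.1 e.1 e'.1
  simp only [concaveParabola, sumVertex]
  field_simp at h ⊢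
  linear_combination -h

lemma sumVertex_mem_closedQ₁ {a b : ℝ} (ha : 0 < a) (hb : 0 < b) {e e' z : Space n × ℝ}
    (he : e ∈ closedQ₁ n) (he' : e' ∈ closedQ₁ n) (hz : z.2 ≤ 0)
    (h : 0 ≤ concaveParabola a e.1 e.2 z + concaveParabola b e'.1 e'.2 z) :
    sumVertex a b e e' ∈ closedQ₁ n := by
  have hab : 0 < a + b := add_pos ha hb
  refine ⟨?_, ?_, ?_⟩
  · have hmem := convex_closedBall (0 : Space n) 1 he.1 he'.1 (div_pos ha hab).le
      (div_pos hb hab).le (by field_simp)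
    simpa only [sumVertex, smul_add, smul_smul, div_eq_inv_mul] using hmem
  · have hmean : -1 ≤ (a * e.2 + b * e'.2) / (a + b) := by
      rw [le_div_iff₀ hab]
      nlinarith [he.2.1, he'.2.1]
    exact hmean.trans (le_add_of_nonneg_right (by positivity))
  · rw [concaveParabola_add hab.ne', concaveParabola_eq_mul_zeroTime, zeroTime] at h
    have := nonneg_of_mul_nonneg_right h hab
    linarith [sq_nonneg ‖z.1 - (sumVertex a b e e').1‖]

end Vertices

section VertexGap

variable {n : ℕ} {lam Lam δ : ℝ} {v : Space n × ℝ → ℝ} {a b r : ℝ} {e₀ e₁ e₂ z₁ z₂ : Space n × ℝ}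

lemma IsEllipticSupersolution.vertex_gap_of_le (hv : IsEllipticSupersolution lam Lam δ v)
    (hell : IsEllipticityPair lam Lam) (ha : 0 < a) (hab : a ≤ b) (hr : 0 < r)
    (hδ : 14 * Lam / lam * (a + b) < δ) (ht : z₁.2 ≤ z₂.2) (htr : z₂.2 ≤ z₁.2 + r ^ 2)
    (hx : ‖z₂.1 - z₁.1‖ ≤ r)
    (hQ : Metric.closedBall z₁.1 (gapRadius lam Lam * r) ×ˢ
      Icc (z₁.2 - (gapRadius lam Lam * r) ^ 2) z₂.2 ⊆ Q₁ n)
    (h₁ : TouchesBelow (fun z => concaveParabola a e₀.1 e₀.2 z + concaveParabola b e₁.1 e₁.2 z)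
      v z₁.1 z₁.2)
    (h₂ : TouchesBelow (fun z => concaveParabola a e₀.1 e₀.2 z + concaveParabola b e₂.1 e₂.2 z)
      v z₂.1 z₂.2) :
    ‖e₂.1 - e₁.1‖ ≤ 2 * gapSlope lam Lam * r ∧ 0 ≤ zeroTime z₁.1 e₂ - zeroTime z₁.1 e₁ ∧
      zeroTime z₁.1 e₂ - zeroTime z₁.1 e₁ ≤ 16 * Lam * gapSlope lam Lam * r ^ 2 := by
  have hC := hell.gapSlope_pos
  have hL := hell.Lam_pos
  have hb : 0 < b := ha.trans_le hab
  have hab₀ : 0 < a + b := add_pos ha hb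
  simp only [concaveParabola_eq_add_tilt b e₁ e₂ _ z₁.1, ← add_assoc,
    concaveParabola_add hab₀.ne'] at h₁ h₂
  obtain ⟨hg, hD₀, hD⟩ := hv.tilt_bounds hell hab₀ hr hδ ht htr hx hQ h₁ h₂
  rw [norm_smul, Real.norm_eq_abs, abs_of_pos hb] at hg
  have hab₂ : a + b ≤ 2 * b := by linarith
  refine ⟨le_of_mul_le_mul_left (hg.trans ?_) hb, nonneg_of_mul_nonneg_right hD₀ hb,
    le_of_mul_le_mul_left (hD.trans ?_) hb⟩
  · calc gapSlope lam Lam * (a + b) * r ≤ gapSlope lam Lam * (2 * b) * r := by gcongr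
      _ = b * (2 * gapSlope lam Lam * r) := by ring
  · calc 8 * Lam * (gapSlope lam Lam * (a + b) * r) * r
        ≤ 8 * Lam * (gapSlope lam Lam * (2 * b) * r) * r := by gcongr
      _ = b * (16 * Lam * gapSlope lam Lam * r ^ 2) := by ring

-- `vertex_gap_of_le` read at the earlier contact point; if that is `z₂`, changing the base point of
-- the shear back to `z₁` costs `⟪e₁ - e₂, z₁ - z₂⟫`.
lemma IsEllipticSupersolution.vertex_gap (hv : IsEllipticSupersolution lam Lam δ v)
    (hell : IsEllipticityPair lam Lam) (ha : 0 < a) (hab : a ≤ b) (hr : 0 < r)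
    (hδ : 14 * Lam / lam * (a + b) < δ) (htr : |z₂.2 - z₁.2| ≤ r ^ 2)
    (hx : ‖z₂.1 - z₁.1‖ ≤ r) (hz₁ : z₁.2 ≤ 0) (hz₂ : z₂.2 ≤ 0)
    (hQ : Metric.closedBall z₁.1 (2 * gapRadius lam Lam * r) ×ˢ
      Icc (z₁.2 - (2 * gapRadius lam Lam * r) ^ 2) 0 ⊆ Q₁ n)
    (h₁ : TouchesBelow (fun z => concaveParabola a e₀.1 e₀.2 z + concaveParabola b e₁.1 e₁.2 z)
      v z₁.1 z₁.2)
    (h₂ : TouchesBelow (fun z => concaveParabola a e₀.1 e₀.2 z + concaveParabola b e₂.1 e₂.2 z)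
      v z₂.1 z₂.2) :
    ‖e₂.1 - e₁.1‖ ≤ 2 * gapSlope lam Lam * r ∧
      |zeroTime z₁.1 e₂ - zeroTime z₁.1 e₁| ≤ 18 * Lam * gapSlope lam Lam * r ^ 2 := by
  have hL := hell.one_le
  have hC := hell.gapSlope_pos
  have hR : r ≤ gapRadius lam Lam * r :=
    le_mul_of_one_le_left hr.le (by linarith [hell.le_gapRadius])
  have hR₂ : r ^ 2 ≤ (gapRadius lam Lam * r) ^ 2 := pow_le_pow_left₀ hr.le hR 2
  have hR₄ : (2 * gapRadius lam Lam * r) ^ 2 = 4 * (gapRadius lam Lam * r) ^ 2 := by ring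
  have hCr : 0 < gapSlope lam Lam * r ^ 2 := mul_pos hC (pow_pos hr 2)
  have hLCr : gapSlope lam Lam * r ^ 2 ≤ Lam * (gapSlope lam Lam * r ^ 2) :=
    le_mul_of_one_le_left hCr.le hL
  rw [abs_le] at htr
  rcases le_total z₁.2 z₂.2 with ht | ht
  · obtain ⟨hy, hs₀, hs⟩ := hv.vertex_gap_of_le hell ha hab hr hδ ht (by linarith) hx
      ((Set.prod_mono (Metric.closedBall_subset_closedBall (by linarith))
        (Icc_subset_Icc (by linarith) hz₂)).trans hQ) h₁ h₂
    exact ⟨hy, by rw [abs_of_nonneg hs₀]; linarith⟩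
  · rw [norm_sub_rev] at hx
    obtain ⟨hy, hs₀, hs⟩ := hv.vertex_gap_of_le hell ha hab hr hδ ht (by linarith) hx
      ((Set.prod_mono (Metric.closedBall_subset_closedBall' (by
        rw [dist_eq_norm, norm_sub_rev]; linarith)) (Icc_subset_Icc (by linarith) hz₁)).trans hQ)
      h₂ h₁
    have hshear := zeroTime_sub_zeroTime e₂ e₁ z₂.1 z₁.1
    have hinner : |⟪e₁.1 - e₂.1, z₁.1 - z₂.1⟫| ≤ 2 * (gapSlope lam Lam * r ^ 2) := by
      calc _ ≤ ‖e₁.1 - e₂.1‖ * ‖z₁.1 - z₂.1‖ := abs_real_inner_le_norm _ _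
        _ ≤ 2 * gapSlope lam Lam * r * r := by gcongr
        _ = 2 * (gapSlope lam Lam * r ^ 2) := by ring
    refine ⟨by rwa [norm_sub_rev], ?_⟩
    rw [abs_le] at hinner ⊢
    constructor <;> linarith

end VertexGap

section Volume

variable {n : ℕ}

lemma volume_cylinder (x : Space n) {R : ℝ} (hR : 0 ≤ R) (t₁ t₂ : ℝ) :
    volume (Metric.closedBall x R ×ˢ Icc t₁ t₂) =
      ENNReal.ofReal (R ^ n * (t₂ - t₁)) * volume (Metric.ball (0 : Space n) 1) := by
  rw [Measure.volume_eq_prod, Measure.prod_prod, Real.volume_Icc, Measure.addHaar_closedBall _ _ hR,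
    finrank_euclideanSpace_fin, ENNReal.ofReal_mul (pow_nonneg hR n), mul_right_comm]

lemma volume_openCylinder (x : Space n) {R : ℝ} (hR : 0 < R) (t₁ t₂ : ℝ) :
    volume (Metric.ball x R ×ˢ Ioo t₁ t₂) =
      ENNReal.ofReal (R ^ n * (t₂ - t₁)) * volume (Metric.ball (0 : Space n) 1) := by
  rw [Measure.volume_eq_prod, Measure.prod_prod, Real.volume_Ioo,
    Measure.addHaar_ball_of_pos _ _ hR, finrank_euclideanSpace_fin,
    ENNReal.ofReal_mul (pow_nonneg hR.le n), mul_right_comm]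

lemma measurePreserving_zeroTime (x : Space n) :
    MeasurePreserving fun e : Space n × ℝ => (e.1, zeroTime x e) :=
  (MeasurePreserving.id volume).skew_product (g := fun y s => s + ‖x - y‖ ^ 2 / 2)
    (by fun_prop) (ae_of_all _ fun _ => map_add_right_eq_self _ _)

lemma volume_shearedCylinder (x : Space n) (e : Space n × ℝ) {R : ℝ} (hR : 0 ≤ R) (h : ℝ) :
    volume {w : Space n × ℝ | ‖w.1 - e.1‖ ≤ R ∧ |zeroTime x w - zeroTime x e| ≤ h} =
      ENNReal.ofReal (R ^ n * (2 * h)) * volume (Metric.ball (0 : Space n) 1) := by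
  have hpre : {w : Space n × ℝ | ‖w.1 - e.1‖ ≤ R ∧ |zeroTime x w - zeroTime x e| ≤ h} =
      (fun w : Space n × ℝ => (w.1, zeroTime x w)) ⁻¹'
        (Metric.closedBall e.1 R ×ˢ Icc (zeroTime x e - h) (zeroTime x e + h)) := by
    ext w
    simp only [mem_ofPred_eq, mem_preimage, mem_prod, mem_closedBall_iff_norm, mem_Icc_iff_abs_le,
      abs_sub_comm]
  rw [hpre, (measurePreserving_zeroTime x).measure_preimage
    (measurableSet_closedBall.prod measurableSet_Icc).nullMeasurableSet, volume_cylinder e.1 hR]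
  congr 3
  ring

end Volume

section Covering

-- The `D i` of a disjoint subfamily of the `B i` lie in `U`, while the `S i` still cover `V`.
lemma measure_le_mul_of_disjoint_subfamily {α : Type*} [TopologicalSpace α]
    [TopologicalSpace.SeparableSpace α] [MeasurableSpace α] {μ : Measure α} {V U : Set α}
    {B D S : V → Set α} {r : V → ℝ} {R : ℝ} {C : ENNReal} (hr : ∀ i, 0 ≤ r i) (hrR : ∀ i, r i ≤ R)
    (hB : ∀ i, (interior (B i)).Nonempty)
    (hS : ∀ i j, (B i ∩ B j).Nonempty → r i ≤ 2 * r j → (i : α) ∈ S j)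
    (hDB : ∀ i, D i ⊆ B i) (hDU : ∀ i, D i ⊆ U) (hD : ∀ i, MeasurableSet (D i))
    (hSD : ∀ i, μ (S i) ≤ C * μ (D i)) : μ V ≤ C * μ U := by
  obtain ⟨T, -, hdisj, hcover⟩ := Vitali.exists_disjoint_subfamily_covering_enlargement B univ r 2
    one_lt_two (fun i _ => hr i) R (fun i _ => hrR i) fun i _ => (hB i).mono interior_subset
  have hT : T.Countable := hdisj.countable_of_nonempty_interior fun i _ => hB i
  have hV : V ⊆ ⋃ i ∈ T, S i := fun x hx => by
    obtain ⟨j, hj, hmeet, hle⟩ := hcover ⟨x, hx⟩ (mem_univ _)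
    exact mem_iUnion₂.2 ⟨j, hj, hS _ j hmeet hle⟩
  calc μ V ≤ ∑' i : T, μ (S i) := (measure_mono hV).trans (measure_biUnion_le μ hT S)
    _ ≤ ∑' i : T, C * μ (D i) := ENNReal.tsum_le_tsum fun i => hSD i
    _ = C * μ (⋃ i ∈ T, D i) := by
        rw [ENNReal.tsum_mul_left, measure_biUnion hT (hdisj.mono hDB) fun i _ => hD i]
    _ ≤ C * μ U := by gcongr; exact iUnion₂_subset fun i _ => hDU i

end Covering

section VertexMeasure

variable {n : ℕ} {lam Lam δ : ℝ} {v : Space n × ℝ → ℝ}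

/-- The factor by which a set of vertices can be larger, in measure, than the set of the
corresponding contact points. -/
noncomputable def vertexConst (n : ℕ) (lam Lam : ℝ) : ℝ :=
  (6 * gapSlope lam Lam) ^ n * (162 * Lam * gapSlope lam Lam)

lemma IsEllipticityPair.vertexConst_pos (hell : IsEllipticityPair lam Lam) :
    0 < vertexConst n lam Lam := by
  have := hell.gapSlope_pos
  have := hell.Lam_pos
  unfold vertexConst
  positivity

/-- The open parabolic cylinder of radius `r` centred at `z`. -/
def openCylinder (z : Space n × ℝ) (r : ℝ) : Set (Space n × ℝ) :=
  Metric.ball z.1 r ×ˢ Ioo (z.2 - r ^ 2) (z.2 + r ^ 2)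

lemma isOpen_openCylinder (z : Space n × ℝ) (r : ℝ) : IsOpen (openCylinder z r) :=
  Metric.isOpen_ball.prod isOpen_Ioo

lemma mem_openCylinder_self (z : Space n × ℝ) {r : ℝ} (hr : 0 < r) : z ∈ openCylinder z r :=
  ⟨Metric.mem_ball_self hr, by linarith [pow_pos hr 2], by linarith [pow_pos hr 2]⟩

lemma exists_openCylinder_subset (M : ℝ) {U : Set (Space n × ℝ)} (hU : IsOpen U)
    {z : Space n × ℝ} (hzU : z ∈ U) (hzQ : z ∈ Q₁ n) :
    ∃ r ∈ Ioc (0 : ℝ) 1, openCylinder z r ⊆ U ∧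
      Metric.closedBall z.1 (M * r) ×ˢ Icc (z.2 - (M * r) ^ 2) 0 ⊆ Q₁ n := by
  obtain ⟨ε, hε, hεU⟩ := Metric.isOpen_iff.1 hU z hzU
  have hsmall {f : ℝ → ℝ} (hf : Continuous f) (h₀ : f 0 = 0) {c : ℝ} (hc : 0 < c) :
      ∀ᶠ r in 𝓝[>] 0, f r < c :=
    nhdsWithin_le_nhds (hf.continuousAt.eventually_lt_const (h₀.trans_lt hc))
  obtain ⟨r, hr, hr₁, hrε, hr₂ε, hspace, htime⟩ := (eventually_mem_nhdsWithin.and <|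
    (hsmall continuous_id rfl one_pos).and <| (hsmall continuous_id rfl hε).and <|
    (hsmall (f := fun r => r ^ 2) (by fun_prop) (by simp) hε).and <|
    (hsmall (f := fun r => M * r) (by fun_prop) (by simp)
      (sub_pos.2 (mem_ball_zero_iff.1 hzQ.1))).and <|
    hsmall (f := fun r => (M * r) ^ 2) (by fun_prop) (by simp)
      (neg_lt_iff_pos_add.1 hzQ.2.1)).exists
  refine ⟨r, ⟨hr, hr₁.le⟩, fun w hw => hεU ?_, fun w hw => ⟨?_, ?_, hw.2.2⟩⟩
  · rw [Metric.mem_ball, Prod.dist_eq, Real.dist_eq]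
    refine max_lt ((Metric.mem_ball.1 hw.1).trans hrε) (abs_sub_lt_iff.2 ⟨?_, ?_⟩) <;>
      linarith [hw.2.1, hw.2.2]
  · exact Metric.closedBall_subset_ball' (by rw [dist_zero_right]; linarith) hw.1
  · linarith [hw.2.1]

lemma norm_sub_le_of_openCylinder_inter {z w : Space n × ℝ} {r ρ : ℝ} (hρ₀ : 0 < ρ)
    (hρ : ρ ≤ 2 * r) (h : (openCylinder w ρ ∩ openCylinder z r).Nonempty) :
    ‖w.1 - z.1‖ ≤ 3 * r ∧ |w.2 - z.2| ≤ (3 * r) ^ 2 := by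
  obtain ⟨p, ⟨hpw, hpw₁, hpw₂⟩, hpz, hpz₁, hpz₂⟩ := h
  have hρ₂ : ρ ^ 2 ≤ (2 * r) ^ 2 := pow_le_pow_left₀ hρ₀.le hρ 2
  constructor
  · rw [← dist_eq_norm]
    linarith [dist_triangle_left w.1 z.1 p.1, Metric.mem_ball.1 hpw, Metric.mem_ball.1 hpz]
  · rw [abs_le]
    constructor <;> nlinarith [sq_nonneg r]

variable {a b : ℝ} {e₀ : Space n × ℝ} {V Z : Set (Space n × ℝ)}

lemma IsEllipticSupersolution.volume_vertices_le_of_isOpen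
    (hv : IsEllipticSupersolution lam Lam δ v) (hell : IsEllipticityPair lam Lam) (ha : 0 < a)
    (hab : a ≤ b) (hδ : 14 * Lam / lam * (a + b) < δ) (hZ : Z ⊆ Q₁ n)
    (hV : ∀ e ∈ V, ∃ z ∈ Z, TouchesBelow
      (fun w => concaveParabola a e₀.1 e₀.2 w + concaveParabola b e.1 e.2 w) v z.1 z.2)
    {U : Set (Space n × ℝ)} (hU : IsOpen U) (hZU : Z ⊆ U) :
    volume V ≤ ENNReal.ofReal (vertexConst n lam Lam) * volume U := by
  choose z hzZ hz using fun e : V => hV e e.2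
  choose r hr hrU hrQ using fun e : V =>
    exists_openCylinder_subset (6 * gapRadius lam Lam) hU (hZU (hzZ e)) (hZ (hzZ e))
  have hC := hell.gapSlope_pos
  have hκ := hell.vertexConst_pos (n := n)
  have hscale (M ρ : ℝ) : 6 * M * ρ = 2 * M * (3 * ρ) := by ring
  refine measure_le_mul_of_disjoint_subfamily (r := r) (R := 1)
    (B := fun e => openCylinder (z e) (r e)) (D := fun e => openCylinder (z e) (r e))
    (S := fun e => {w | ‖w.1 - e.1.1‖ ≤ 6 * gapSlope lam Lam * r e ∧
      |zeroTime (z e).1 w - zeroTime (z e).1 e| ≤ 162 * Lam * gapSlope lam Lam * r e ^ 2})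
    (fun e => (hr e).1.le) (fun e => (hr e).2) (fun e => ?_) (fun i j hmeet hle => ?_)
    (fun _ => subset_rfl) hrU (fun e => (isOpen_openCylinder _ _).measurableSet) fun e => ?_
  · rw [(isOpen_openCylinder _ _).interior_eq]
    exact ⟨z e, mem_openCylinder_self _ (hr e).1⟩
  · obtain ⟨hx, ht⟩ := norm_sub_le_of_openCylinder_inter (hr i).1 hle hmeet
    obtain ⟨hgap, hshear⟩ := hv.vertex_gap hell ha hab (mul_pos three_pos (hr j).1) hδ ht hx
      (hZ (hzZ j)).2.2 (hZ (hzZ i)).2.2 (hscale _ _ ▸ hrQ j) (hz j) (hz i)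
    exact ⟨hgap.trans_eq (by ring), hshear.trans_eq (by ring)⟩
  · have hre := (hr e).1
    rw [volume_shearedCylinder _ _ (by positivity), openCylinder, volume_openCylinder _ hre,
      ← mul_assoc (ENNReal.ofReal (vertexConst n lam Lam)), ← ENNReal.ofReal_mul hκ.le, vertexConst]
    refine le_of_eq (congrArg (ENNReal.ofReal · * _) ?_)
    ring

lemma IsEllipticSupersolution.volume_vertices_le
    (hv : IsEllipticSupersolution lam Lam δ v) (hell : IsEllipticityPair lam Lam) (ha : 0 < a)
    (hab : a ≤ b) (hδ : 14 * Lam / lam * (a + b) < δ) (hZ : Z ⊆ Q₁ n)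
    (hV : ∀ e ∈ V, ∃ z ∈ Z, TouchesBelow
      (fun w => concaveParabola a e₀.1 e₀.2 w + concaveParabola b e.1 e.2 w) v z.1 z.2) :
    volume V ≤ ENNReal.ofReal (vertexConst n lam Lam) * volume Z := by
  rw [← ENNReal.inv_mul_le_iff (ENNReal.ofReal_pos.2 hell.vertexConst_pos).ne'
    ENNReal.ofReal_ne_top, Z.measure_eq_iInf_isOpen]
  refine le_iInf₂ fun U hZU => le_iInf fun hU => ?_
  rw [ENNReal.inv_mul_le_iff (ENNReal.ofReal_pos.2 hell.vertexConst_pos).ne' ENNReal.ofReal_ne_top]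
  exact hv.volume_vertices_le_of_isOpen hell ha hab hδ hZ hV hU hZU

end VertexMeasure

section ContactSets

variable {n : ℕ} {v : Space n × ℝ → ℝ} {a a' : ℝ}

/-- The non-strict variant of the contact set, for contact points in `Q₁`. Unlike `contactSet`, it
is relatively closed in `Q₁`. -/
def closedContactSet (a : ℝ) (v : Space n × ℝ → ℝ) : Set (Space n × ℝ) :=
  {z | z ∈ Q₁ n ∧ ∃ e ∈ closedQ₁ n, TouchesBelow (concaveParabola a e.1 e.2) v z.1 z.2}

lemma Q₁_subset_closedQ₁ : Q₁ n ⊆ closedQ₁ n :=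
  Set.prod_mono Metric.ball_subset_closedBall Ioc_subset_Icc_self

lemma isCompact_closedQ₁ : IsCompact (closedQ₁ n) :=
  (isCompact_closedBall _ _).prod isCompact_Icc

lemma ContactsBelow.touchesBelow {φ : Space n × ℝ → ℝ} {x : Space n} {t : ℝ}
    (h : ContactsBelow φ v x t) (hc : ContinuousOn v (Metric.closedBall 0 1 ×ˢ univ))
    (hφ : Continuous φ) : TouchesBelow φ v x t :=
  ⟨liesBelow_of_forall_ball hc hφ fun ξ hξ τ hτ => (h.1 ξ hξ τ hτ).le, h.2⟩

lemma mem_closedContactSet_of_contactsBelow (hc : ContinuousOn v (Metric.closedBall 0 1 ×ˢ univ))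
    {e z : Space n × ℝ} (he : e ∈ closedQ₁ n) (hz : z ∈ Q₁ n)
    (h : ContactsBelow (concaveParabola a e.1 e.2) v z.1 z.2) : z ∈ closedContactSet a v :=
  ⟨hz, e, he, h.touchesBelow hc (contDiff_concaveParabola a e.1 e.2).continuous⟩

-- Adding the parabola of opening `a' - a` with vertex at the contact point itself makes the contact
-- strict.
lemma exists_contactsBelow_of_lt (hv₀ : ∀ z ∈ Q₁ n, 0 ≤ v z) (ha : 0 < a) (haa' : a < a')
    {z : Space n × ℝ} (hz : z ∈ closedContactSet a v) :
    ∃ e ∈ closedQ₁ n, ContactsBelow (concaveParabola a' e.1 e.2) v z.1 z.2 := by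
  obtain ⟨hzQ, e, he, hbelow, heq⟩ := hz
  have hb : 0 < a' - a := sub_pos.2 haa'
  have hsum (w : Space n × ℝ) : concaveParabola a e.1 e.2 w + concaveParabola (a' - a) z.1 z.2 w =
      concaveParabola a' (sumVertex a (a' - a) e z).1 (sumVertex a (a' - a) e z).2 w := by
    rw [concaveParabola_add (add_pos ha hb).ne', add_sub_cancel]
  have hvertex : concaveParabola (a' - a) z.1 z.2 z = 0 := by simp [concaveParabola]
  have hneg (ξ : Space n) {τ : ℝ} (hτ : τ < z.2) : concaveParabola (a' - a) z.1 z.2 (ξ, τ) < 0 := by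
    have : (a' - a) * (τ - z.2) < 0 := mul_neg_of_pos_of_neg hb (sub_neg.2 hτ)
    rw [concaveParabola]
    nlinarith [sq_nonneg ‖ξ - z.1‖]
  have heq' : concaveParabola a e.1 e.2 z = v z := heq
  refine ⟨sumVertex a (a' - a) e z, sumVertex_mem_closedQ₁ ha hb he (Q₁_subset_closedQ₁ hzQ)
    hzQ.2.2 ?_, fun ξ hξ τ hτ => ?_, ?_⟩
  · rw [hvertex, add_zero, heq']
    exact hv₀ z hzQ
  · rw [← hsum]
    linarith [hneg ξ hτ, hbelow ξ (Metric.ball_subset_closedBall hξ) τ hτ.le]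
  · rw [← hsum, hvertex, add_zero, heq']

lemma closedContactSet_mono (hc : ContinuousOn v (Metric.closedBall 0 1 ×ˢ univ))
    (hv₀ : ∀ z ∈ Q₁ n, 0 ≤ v z) (ha : 0 < a) (haa' : a ≤ a') :
    closedContactSet a v ⊆ closedContactSet a' v := by
  rcases haa'.eq_or_lt with rfl | haa'
  · exact subset_rfl
  intro z hz
  obtain ⟨e, he, h⟩ := exists_contactsBelow_of_lt hv₀ ha haa' hz
  exact mem_closedContactSet_of_contactsBelow hc he hz.1 h

lemma continuous_concaveParabola_prod (a : ℝ) :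
    Continuous fun p : (Space n × ℝ) × (Space n × ℝ) => concaveParabola a p.2.1 p.2.2 p.1 := by
  unfold concaveParabola
  fun_prop

lemma isClosed_setOf_liesBelow (hc : ContinuousOn v (Metric.closedBall 0 1 ×ˢ univ)) (a : ℝ) :
    IsClosed {p : (Space n × ℝ) × (Space n × ℝ) |
      LiesBelow (concaveParabola a p.2.1 p.2.2) v p.1.2} := by
  have hshift : {p : (Space n × ℝ) × (Space n × ℝ) |
      LiesBelow (concaveParabola a p.2.1 p.2.2) v p.1.2} =
      ⋂ ξ ∈ Metric.closedBall (0 : Space n) 1, ⋂ σ ∈ Ici (0 : ℝ),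
        {p | concaveParabola a p.2.1 p.2.2 (ξ, p.1.2 - σ) ≤ v (ξ, p.1.2 - σ)} := by
    ext p
    simp only [mem_iInter]
    exact ⟨fun h ξ hξ σ hσ => h ξ hξ _ (sub_le_self _ hσ), fun h ξ hξ τ hτ => by
      simpa using h ξ hξ (p.1.2 - τ) (sub_nonneg.2 hτ)⟩
  rw [hshift]
  refine isClosed_biInter fun ξ hξ => isClosed_biInter fun σ _ => isClosed_le ?_ ?_
  · exact (continuous_concaveParabola_prod a).comp
      (f := fun p : (Space n × ℝ) × (Space n × ℝ) => ((ξ, p.1.2 - σ), p.2)) (by fun_prop)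
  · exact hc.comp_continuous (f := fun p : (Space n × ℝ) × (Space n × ℝ) => (ξ, p.1.2 - σ))
      (by fun_prop) fun p => ⟨hξ, mem_univ _⟩

lemma isCompact_inter_closedContactSet (hc : ContinuousOn v (Metric.closedBall 0 1 ×ˢ univ))
    {K : Set (Space n × ℝ)} (hK : IsCompact K) (hKQ : K ⊆ Q₁ n) (a : ℝ) :
    IsCompact (K ∩ closedContactSet a v) := by
  have hKc : IsCompact (K ×ˢ closedQ₁ n) := hK.prod isCompact_closedQ₁
  have hvK : ContinuousOn (fun p : (Space n × ℝ) × (Space n × ℝ) => v p.1) (K ×ˢ closedQ₁ n) :=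
    hc.comp continuousOn_fst fun p hp => ⟨mem_closedBall_of_mem_Q₁ (hKQ hp.1), mem_univ _⟩
  have htouch : IsCompact ({p ∈ K ×ˢ closedQ₁ n | concaveParabola a p.2.1 p.2.2 p.1 = v p.1} ∩
      {p | LiesBelow (concaveParabola a p.2.1 p.2.2) v p.1.2}) :=
    (hKc.of_isClosed_subset (hKc.isClosed.isClosed_eq
      (continuous_concaveParabola_prod a).continuousOn hvK) (sep_subset _ _)).inter_right
      (isClosed_setOf_liesBelow hc a)
  convert htouch.image continuous_fst using 1
  ext z
  constructor
  · rintro ⟨hzK, -, e, he, hbelow, heq⟩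
    exact ⟨(z, e), ⟨⟨⟨hzK, he⟩, heq⟩, hbelow⟩, rfl⟩
  · rintro ⟨⟨z, e⟩, ⟨⟨⟨hzK, he⟩, heq⟩, hbelow⟩, rfl⟩
    exact ⟨hzK, hKQ hzK, e, he, hbelow, heq⟩

end ContactSets

section MiddleCylinders

variable {n : ℕ} {θ T₀ r R : ℝ} {z z₁ z₀ w : Space n × ℝ} {c : Space n}

lemma isClosed_lowerPB (θ T₀ : ℝ) (x₀ : Space n) (t₀ : ℝ) : IsClosed (lowerPB θ T₀ x₀ t₀) := by
  have hcone : IsClosed {z : Space n × ℝ | θ * ‖z.1 - x₀‖ ^ 2 ≤ t₀ - z.2} :=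
    isClosed_le (by fun_prop) (by fun_prop)
  have hslab : IsClosed {z : Space n × ℝ | t₀ - z.2 ≤ T₀} :=
    isClosed_le (by fun_prop) (by fun_prop)
  exact hcone.inter hslab

lemma isCompact_lowerPB (hQ : lowerPB θ T₀ z₀.1 z₀.2 ⊆ Q₁ n) :
    IsCompact (lowerPB θ T₀ z₀.1 z₀.2) :=
  isCompact_closedQ₁.of_isClosed_subset (isClosed_lowerPB _ _ _ _) (hQ.trans Q₁_subset_closedQ₁)

lemma apex_mem_lowerPB (hT₀ : 0 ≤ T₀) : z₀ ∈ lowerPB θ T₀ z₀.1 z₀.2 :=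
  ⟨by simp, by simpa using hT₀⟩

lemma exists_first_mem_upperPB {A : Set (Space n × ℝ)} (hA : IsCompact A) (hz₀ : z₀ ∈ A)
    (hz : θ * ‖z₀.1 - z.1‖ ^ 2 ≤ z₀.2 - z.2) :
    ∃ z₁ ∈ A, θ * ‖z₁.1 - z.1‖ ^ 2 ≤ z₁.2 - z.2 ∧ z₁.2 ≤ z₀.2 ∧
      ∀ w ∈ A, θ * ‖w.1 - z.1‖ ^ 2 ≤ w.2 - z.2 → z₁.2 ≤ w.2 := by
  have hupper : IsCompact (A ∩ {w | θ * ‖w.1 - z.1‖ ^ 2 ≤ w.2 - z.2}) :=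
    hA.inter_right (isClosed_le (by fun_prop) (by fun_prop))
  obtain ⟨z₁, ⟨hz₁A, hz₁⟩, hmin⟩ :=
    hupper.exists_isMinOn ⟨z₀, hz₀, hz⟩ continuous_snd.continuousOn
  rw [isMinOn_iff] at hmin
  exact ⟨z₁, hz₁A, hz₁, hmin z₀ ⟨hz₀, hz⟩, fun w hw hwz => hmin w ⟨hw, hwz⟩⟩

/-- The points `z₁` and `z₀` lie in the upward paraboloid with vertex `z`, at the heights `θ r²` and
`θ R²`, and `c` is a space point well inside both the section of that paraboloid at `z₁` and the
section at `z` of the downward paraboloid with vertex `z₀`. -/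
structure IsMiddleConfiguration (θ r R : ℝ) (z z₁ z₀ : Space n × ℝ) (c : Space n) : Prop where
  pos : 0 < r
  le : r ≤ R
  contact_time : z₁.2 = z.2 + θ * r ^ 2
  apex_time : z₀.2 = z.2 + θ * R ^ 2
  norm_contact_sub_le : ‖z₁.1 - z.1‖ ≤ r
  norm_sub_le : ‖c - z.1‖ ≤ 3 / 5 * r
  norm_sub_apex_le : ‖c - z₀.1‖ ≤ R - 3 / 5 * r

/-- The cylinder about `c` between the heights `θ r² / 2` and `3 θ r² / 4` above the time `t`, in
which contact points of larger opening are found. -/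
def midCylinder (θ r t : ℝ) (c : Space n) : Set (Space n × ℝ) :=
  Metric.closedBall c (r / 10) ×ˢ Icc (t + θ * r ^ 2 / 2) (t + 3 * (θ * r ^ 2) / 4)

lemma isClosed_midCylinder (θ r t : ℝ) (c : Space n) : IsClosed (midCylinder θ r t c) :=
  Metric.isClosed_closedBall.prod isClosed_Icc

lemma nonempty_interior_midCylinder (hθ : 0 < θ) (hr : 0 < r) (t : ℝ) (c : Space n) :
    (interior (midCylinder θ r t c)).Nonempty := by
  have : 0 < θ * r ^ 2 := by positivity
  rw [midCylinder, interior_prod_eq, interior_Icc]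
  exact ⟨(c, t + 5 * (θ * r ^ 2) / 8), Metric.ball_subset_interior_closedBall
    (Metric.mem_ball_self (by positivity)), by simp only; linarith, by simp only; linarith⟩

lemma norm_sub_le_of_mul_sq_le (hθ : 0 < θ) (hR : 0 ≤ R) {x y : Space n}
    (h : θ * ‖x - y‖ ^ 2 ≤ θ * R ^ 2) : ‖x - y‖ ≤ R :=
  le_of_sq_le_sq (le_of_mul_le_mul_left h hθ) hR

-- The point `z₁` is the first one of `A` in the upward paraboloid with vertex `z`, and the middle
-- cylinder lies in that paraboloid below `z₁`.
lemma exists_isMiddleConfiguration (hθ : 0 < θ) {A : Set (Space n × ℝ)} (hA : IsCompact A)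
    (hz₀ : z₀ ∈ A) (hz : θ * ‖z.1 - z₀.1‖ ^ 2 ≤ z₀.2 - z.2) (hzA : z ∉ A) :
    ∃ r R z₁ c, z₁ ∈ A ∧ IsMiddleConfiguration θ r R z z₁ z₀ c ∧
      ∀ w ∈ A, θ * ‖w.1 - z.1‖ ^ 2 ≤ w.2 - z.2 → z₁.2 ≤ w.2 := by
  obtain ⟨z₁, hz₁A, hz₁, hz₁₀, hfirst⟩ :=
    exists_first_mem_upperPB hA hz₀ (by rwa [norm_sub_rev])
  have hpos : 0 < z₁.2 - z.2 := by
    refine lt_of_le_of_ne ((by positivity : 0 ≤ θ * ‖z₁.1 - z.1‖ ^ 2).trans hz₁) fun h => hzA ?_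
    have hspace : ‖z₁.1 - z.1‖ ≤ 0 := norm_sub_le_of_mul_sq_le hθ le_rfl (by linarith)
    rwa [← Prod.ext (sub_eq_zero.1 (norm_le_zero_iff.1 hspace)) (sub_eq_zero.1 h.symm)]
  have hroot {s : ℝ} (hs : 0 < s) : ∃ r, 0 < r ∧ θ * r ^ 2 = s :=
    ⟨√(s / θ), Real.sqrt_pos.2 (div_pos hs hθ), by
      rw [Real.sq_sqrt (div_pos hs hθ).le, mul_div_cancel₀ _ hθ.ne']⟩
  obtain ⟨r, hr, hr_sq⟩ := hroot hpos
  obtain ⟨R, hR, hR_sq⟩ := hroot (hpos.trans_le (sub_le_sub_right hz₁₀ _))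
  have hrR : r ≤ R := le_of_sq_le_sq (le_of_mul_le_mul_left (by linarith) hθ) hR.le
  obtain ⟨c, hzc, hcz₀⟩ := exists_dist_le_le (x := z.1) (z := z₀.1) (δ := 3 / 5 * r)
    (ε := R - 3 / 5 * r) (by positivity) (by linarith) (by
      rw [sub_add_cancel, dist_eq_norm]
      exact norm_sub_le_of_mul_sq_le hθ hR.le (by rwa [hR_sq]))
  rw [dist_comm, dist_eq_norm] at hzc
  rw [dist_eq_norm] at hcz₀
  exact ⟨r, R, z₁, c, hz₁A, ⟨hr, hrR, by linarith, by linarith,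
    norm_sub_le_of_mul_sq_le hθ hr.le (by rwa [hr_sq]), hzc, hcz₀⟩, hfirst⟩

namespace IsMiddleConfiguration

lemma norm_sub_base_le (h : IsMiddleConfiguration θ r R z z₁ z₀ c)
    (hw : w ∈ midCylinder θ r z.2 c) : ‖w.1 - z.1‖ ≤ 7 / 10 * r := by
  have hwc : ‖w.1 - c‖ ≤ r / 10 := mem_closedBall_iff_norm.1 hw.1
  linarith [norm_sub_le_norm_sub_add_norm_sub w.1 c z.1, h.norm_sub_le]

lemma mul_norm_sub_base_sq_le (h : IsMiddleConfiguration θ r R z z₁ z₀ c)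
    (hθ : 0 < θ) (hw : w ∈ midCylinder θ r z.2 c) :
    θ * ‖w.1 - z.1‖ ^ 2 ≤ w.2 - z.2 := by
  calc θ * ‖w.1 - z.1‖ ^ 2 ≤ θ * (7 / 10 * r) ^ 2 := by gcongr; exact h.norm_sub_base_le hw
    _ ≤ θ * r ^ 2 / 2 := by nlinarith [mul_pos hθ (pow_pos h.pos 2)]
    _ ≤ w.2 - z.2 := by linarith [hw.2.1]

lemma lt_contact_time (h : IsMiddleConfiguration θ r R z z₁ z₀ c)
    (hθ : 0 < θ) (hw : w ∈ midCylinder θ r z.2 c) : w.2 < z₁.2 := by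
  linarith [hw.2.2, mul_pos hθ (pow_pos h.pos 2), h.contact_time]

lemma midCylinder_subset_lowerPB (h : IsMiddleConfiguration θ r R z z₁ z₀ c)
    (hθ : 0 < θ) (hz : z ∈ lowerPB θ T₀ z₀.1 z₀.2) :
    midCylinder θ r z.2 c ⊆ lowerPB θ T₀ z₀.1 z₀.2 := by
  intro w hw
  have hr := h.pos
  have hwc : ‖w.1 - c‖ ≤ r / 10 := mem_closedBall_iff_norm.1 hw.1
  have hwz₀ : ‖w.1 - z₀.1‖ ≤ R - r / 2 := by
    linarith [norm_sub_le_norm_sub_add_norm_sub w.1 c z₀.1, h.norm_sub_apex_le]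
  have hsq : (R - r / 2) ^ 2 ≤ R ^ 2 - 3 * r ^ 2 / 4 := by nlinarith [h.le]
  refine ⟨?_, ?_⟩
  · calc θ * ‖w.1 - z₀.1‖ ^ 2 ≤ θ * (R ^ 2 - 3 * r ^ 2 / 4) := by
          gcongr
          exact (pow_le_pow_left₀ (norm_nonneg _) hwz₀ 2).trans hsq
      _ ≤ z₀.2 - w.2 := by linarith [hw.2.2, h.apex_time]
  · linarith [hz.2, h.mul_norm_sub_base_sq_le hθ hw, mul_nonneg hθ.le (sq_nonneg ‖w.1 - z.1‖)]

lemma cylinder_subset_Q₁ (h : IsMiddleConfiguration θ r R z z₁ z₀ c)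
    (hθ : 0 < θ) (hQ : lowerPB θ T₀ z₀.1 z₀.2 ⊆ Q₁ n)
    (hz : z ∈ lowerPB θ T₀ z₀.1 z₀.2) :
    Metric.closedBall z₀.1 R ×ˢ Icc z.2 z₀.2 ⊆ Q₁ n := by
  have hz₀ : z₀ ∈ Q₁ n := hQ (apex_mem_lowerPB (by
    linarith [hz.1, hz.2, mul_nonneg hθ.le (sq_nonneg ‖z.1 - z₀.1‖)]))
  intro w hw
  have hbottom : (w.1, z.2) ∈ Q₁ n := hQ ⟨by
    have := mul_le_mul_of_nonneg_left
      (pow_le_pow_left₀ (norm_nonneg _) (mem_closedBall_iff_norm.1 hw.1) 2) hθ.le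
    linarith [h.apex_time], hz.2⟩
  exact ⟨hbottom.1, hbottom.2.1.trans_le hw.2.1, hw.2.2.trans hz₀.2.2⟩

lemma norm_contact_sub_apex_lt (h : IsMiddleConfiguration θ r R z z₁ z₀ c)
    (hθ : 0 < θ) (hz₁ : z₁ ∈ lowerPB θ T₀ z₀.1 z₀.2) :
    ‖z₁.1 - z₀.1‖ < R := by
  refine lt_of_pow_lt_pow_left₀ 2 (h.pos.le.trans h.le) (lt_of_mul_lt_mul_left ?_ hθ.le)
  linarith [hz₁.1, h.contact_time, h.apex_time, mul_pos hθ (pow_pos h.pos 2)]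

end IsMiddleConfiguration

end MiddleCylinders

section MiddleGrowth

variable {n : ℕ} {lam Lam δ θ T₀ r R a b d : ℝ} {v : Space n × ℝ → ℝ}
  {z z₁ z₀ e e' : Space n × ℝ} {c x : Space n}

lemma tube_axis_subset {c₀ c₁ x₀ : Space n} {ρ t₀ t₁ : ℝ} (ht : t₀ < t₁)
    (hc₀ : c₀ ∈ Metric.closedBall x₀ (R - ρ)) (hc₁ : c₁ ∈ Metric.closedBall x₀ (R - ρ)) :
    tube (axis c₀ ((t₁ - t₀)⁻¹ • (c₁ - c₀)) t₀) ρ t₀ t₁ ⊆ Metric.closedBall x₀ R ×ˢ Icc t₀ t₁ := by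
  rintro w ⟨hwt, hw⟩
  have hfraction : (w.2 - t₀) / (t₁ - t₀) ∈ Icc (0 : ℝ) 1 :=
    ⟨div_nonneg (sub_nonneg.2 hwt.1) (sub_pos.2 ht).le,
      (div_le_one (sub_pos.2 ht)).2 (sub_le_sub_right hwt.2 _)⟩
  have haxis : axis c₀ ((t₁ - t₀)⁻¹ • (c₁ - c₀)) t₀ w.2 ∈ Metric.closedBall x₀ (R - ρ) := by
    rw [axis, smul_smul, ← div_eq_mul_inv]
    exact (convex_closedBall _ _).add_smul_sub_mem hc₀ hc₁ hfraction
  rw [mem_closedBall_iff_norm] at haxis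
  refine ⟨mem_closedBall_iff_norm.2 ?_, hwt⟩
  exact (norm_sub_le_norm_sub_add_norm_sub _ _ _).trans (by linarith)

lemma IsMiddleConfiguration.exists_le_concaveParabola_add
    (h : IsMiddleConfiguration θ r R z z₁ z₀ c) (hv : IsEllipticSupersolution lam Lam δ v)
    (hell : IsEllipticityPair lam Lam) (ha : 0 < a) (hδ : 13 * growthConst lam Lam * a < δ)
    (hθ : 3 / 4 ≤ θ) (hθ4 : θ ≤ 4) (hQ : lowerPB θ T₀ z₀.1 z₀.2 ⊆ Q₁ n)
    (hz : z ∈ lowerPB θ T₀ z₀.1 z₀.2) (hz₁ : z₁ ∈ lowerPB θ T₀ z₀.1 z₀.2)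
    (htouch : TouchesBelow (concaveParabola a e.1 e.2) v z₁.1 z₁.2) :
    ∃ x₂ ∈ Metric.closedBall c (r / 20), v (x₂, z.2 + 5 * (θ * r ^ 2) / 8) ≤
      concaveParabola a e.1 e.2 (x₂, z.2 + 5 * (θ * r ^ 2) / 8) +
        growthConst lam Lam * a * (r / 20) ^ 2 := by
  have hθ₀ : 0 < θ := by linarith
  have hr := h.pos
  obtain ⟨c₁, hz₁c₁, hc₁⟩ := exists_dist_lt_le (x := z₁.1) (z := z₀.1) (δ := r / 20)
    (ε := R - r / 20) (by positivity) (by linarith [h.le]) (by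
      rw [sub_add_cancel, dist_eq_norm]
      exact h.norm_contact_sub_apex_lt hθ₀ hz₁)
  rw [dist_eq_norm] at hz₁c₁
  have hshift : ‖c₁ - c‖ ≤ 33 / 20 * r := by
    have htriangle := norm_sub_le_norm_sub_add_norm_sub c₁ z₁.1 c
    have htriangle' := norm_sub_le_norm_sub_add_norm_sub z₁.1 z.1 c
    rw [norm_sub_rev] at hz₁c₁
    rw [norm_sub_rev z.1 c] at htriangle'
    linarith [h.norm_contact_sub_le, h.norm_sub_le]
  set t : ℝ := z.2 + 5 * (θ * r ^ 2) / 8 with ht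
  have hr_sq : 0 < r ^ 2 := by positivity
  have hduration : z₁.2 - t = 3 / 8 * θ * r ^ 2 := by rw [h.contact_time]; ring
  have hlong : 9 / 32 * r ^ 2 ≤ z₁.2 - t := by rw [hduration]; gcongr; linarith
  have hshort : z₁.2 - t ≤ 3 / 2 * r ^ 2 := by rw [hduration]; gcongr; linarith
  have htz₁ : t < z₁.2 := by linarith
  have hspeed : ‖(z₁.2 - t)⁻¹ • (c₁ - c)‖ * (r / 20) ≤ 2 / 5 := by
    rw [norm_smul, norm_inv, Real.norm_of_nonneg (sub_pos.2 htz₁).le, mul_assoc,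
      inv_mul_le_iff₀ (sub_pos.2 htz₁)]
    calc ‖c₁ - c‖ * (r / 20) ≤ 33 / 20 * r * (r / 20) := by gcongr
      _ ≤ (z₁.2 - t) * (2 / 5) := by linarith
  have htube : tube (axis c ((z₁.2 - t)⁻¹ • (c₁ - c)) t) (r / 20) t z₁.2 ⊆ Q₁ n := by
    have hc : c ∈ Metric.closedBall z₀.1 (R - r / 20) :=
      mem_closedBall_iff_norm.2 (by linarith [h.norm_sub_apex_le])
    refine (tube_axis_subset htz₁ hc hc₁).trans ((Set.prod_mono subset_rfl ?_).trans
      (h.cylinder_subset_Q₁ hθ₀ hQ hz))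
    exact Icc_subset_Icc (by linarith [mul_pos hθ₀ hr_sq])
      (by linarith [hz₁.1, mul_nonneg hθ₀.le (sq_nonneg ‖z₁.1 - z₀.1‖)])
  have hend : ‖z₁.1 - axis c ((z₁.2 - t)⁻¹ • (c₁ - c)) t z₁.2‖ < r / 20 := by
    rwa [axis, smul_inv_smul₀ (sub_pos.2 htz₁).ne', add_sub_cancel]
  obtain ⟨x₂, hx₂, hle⟩ := hv.exists_le_concaveParabola_add hell ha (by positivity) hδ hspeed
    htz₁.le (by linarith) htube hend htouch
  exact ⟨x₂, mem_closedBall_iff_norm.2 hx₂, hle⟩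

lemma LiesBelow.exists_touchesBelow_add_of_near {t : ℝ}
    (hbelow : LiesBelow (concaveParabola a e.1 e.2) v t)
    (hc : ContinuousOn v (Metric.closedBall 0 1 ×ˢ univ)) (hb : 0 < b) (hd : 0 ≤ d)
    (hx : x ∈ Metric.closedBall (0 : Space n) 1)
    (hnear : v (x, t) ≤ concaveParabola a e.1 e.2 (x, t) + b / 2 * d ^ 2)
    (he' : e' ∈ Metric.closedBall x d ×ˢ Icc (t - 2 * d ^ 2) (t - d ^ 2)) :
    ∃ w ∈ Metric.closedBall e'.1 (2 * d) ×ˢ Icc e'.2 t, TouchesBelow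
      (fun w => concaveParabola a e.1 e.2 w + concaveParabola b e'.1 e'.2 w) v w.1 w.2 := by
  obtain ⟨hex, hbottom, htop⟩ := he'
  have hneg (ξ : Space n) (τ : ℝ) (hτ : τ ≤ e'.2) : concaveParabola b e'.1 e'.2 (ξ, τ) ≤ 0 := by
    have : b * (τ - e'.2) ≤ 0 := mul_nonpos_of_nonneg_of_nonpos hb.le (sub_nonpos.2 hτ)
    have : 0 ≤ b / 2 * ‖ξ - e'.1‖ ^ 2 := by positivity
    rw [concaveParabola]
    linarith
  have hcross : b / 2 * d ^ 2 ≤ concaveParabola b e'.1 e'.2 (x, t) := by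
    have hspace : b / 2 * ‖x - e'.1‖ ^ 2 ≤ b / 2 * d ^ 2 := by
      gcongr
      exact mem_closedBall_iff_norm'.1 hex
    have htime : b * d ^ 2 ≤ b * (t - e'.2) := by gcongr; linarith
    rw [concaveParabola]
    linarith
  obtain ⟨w, hwt, hw, htouch⟩ := exists_touchesBelow_add hc
    (contDiff_concaveParabola a e.1 e.2).continuous
    (contDiff_concaveParabola b e'.1 e'.2).continuous (by linarith [sq_nonneg d]) hbelow hneg hx
    (hnear.trans (by gcongr))
  refine ⟨w, ⟨mem_closedBall_iff_norm.2 (norm_sub_le_of_mul_sq_le hb (by positivity) ?_), hwt⟩,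
    htouch⟩
  have hlate : b * (w.2 - e'.2) ≤ b * (2 * d ^ 2) := by gcongr; linarith [hwt.2]
  rw [concaveParabola] at hw
  linarith

lemma mem_closedContactSet_add {w : Space n × ℝ} (hv₀ : ∀ z ∈ Q₁ n, 0 ≤ v z) (ha : 0 < a)
    (hb : 0 < b) (he : e ∈ closedQ₁ n) (he' : e' ∈ closedQ₁ n) (hw : w ∈ Q₁ n)
    (h : TouchesBelow (fun w => concaveParabola a e.1 e.2 w + concaveParabola b e'.1 e'.2 w)
      v w.1 w.2) : w ∈ closedContactSet (a + b) v := by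
  refine ⟨hw, sumVertex a b e e', sumVertex_mem_closedQ₁ ha hb he he' hw.2.2 ?_, ?_⟩
  · exact (hv₀ w hw).trans_eq h.2.symm
  · rwa [funext (concaveParabola_add (add_pos ha hb).ne' e e')] at h

/-- The factor by which the opening grows in one step of the decay. -/
noncomputable def openingFactor (lam Lam : ℝ) : ℝ := 1 + 18 * growthConst lam Lam

/-- One step of the decay starts from an opening `a` with `smallnessFactor lam Lam * a < δ`, so that
all parabolas it involves have Hessians in the range where `F` is uniformly elliptic. -/
noncomputable def smallnessFactor (lam Lam : ℝ) : ℝ := 14 * Lam / lam * openingFactor lam Lam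

lemma IsEllipticityPair.one_le_openingFactor (hell : IsEllipticityPair lam Lam) :
    1 ≤ openingFactor lam Lam := by
  rw [openingFactor]
  linarith [hell.one_le_growthConst]

lemma IsEllipticityPair.openingFactor_le_smallnessFactor (hell : IsEllipticityPair lam Lam) :
    openingFactor lam Lam ≤ smallnessFactor lam Lam := by
  refine le_mul_of_one_le_left (zero_le_one.trans hell.one_le_openingFactor) ?_
  rw [mul_div_assoc]
  linarith [hell.one_le_div]

lemma IsEllipticityPair.smallnessFactor_pos (hell : IsEllipticityPair lam Lam) :
    0 < smallnessFactor lam Lam :=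
  one_pos.trans_le (hell.one_le_openingFactor.trans hell.openingFactor_le_smallnessFactor)

lemma IsEllipticityPair.growthConst_le_smallnessFactor (hell : IsEllipticityPair lam Lam) :
    13 * growthConst lam Lam ≤ smallnessFactor lam Lam := by
  refine le_trans ?_ hell.openingFactor_le_smallnessFactor
  rw [openingFactor]
  linarith [hell.one_le_growthConst]

lemma cylinder_subset_midCylinder (hθ : 3 / 4 ≤ θ) (r t : ℝ) (c : Space n) :
    Metric.closedBall c (r / 10) ×ˢ
      Icc (t + 5 * (θ * r ^ 2) / 8 - 2 * (r / 60) ^ 2) (t + 5 * (θ * r ^ 2) / 8) ⊆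
        midCylinder θ r t c := by
  have : 3 / 4 * r ^ 2 ≤ θ * r ^ 2 := by gcongr
  exact Set.prod_mono subset_rfl
    (Icc_subset_Icc (by linarith [sq_nonneg r]) (by linarith [sq_nonneg r]))

lemma openingFactor_mul (lam Lam a : ℝ) :
    openingFactor lam Lam * a = a + 18 * growthConst lam Lam * a := by
  rw [openingFactor]
  ring

lemma IsMiddleConfiguration.exists_touchesBelow_midCylinder
    (h : IsMiddleConfiguration θ r R z z₁ z₀ c) (hv : IsEllipticSupersolution lam Lam δ v)
    (hell : IsEllipticityPair lam Lam) (hv₀ : ∀ z ∈ Q₁ n, 0 ≤ v z) (ha : 0 < a)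
    (hδ : smallnessFactor lam Lam * a < δ) (hθ : 3 / 4 ≤ θ) (hθ4 : θ ≤ 4)
    (hQ : lowerPB θ T₀ z₀.1 z₀.2 ⊆ Q₁ n) (hz : z ∈ lowerPB θ T₀ z₀.1 z₀.2)
    (hz₁ : z₁ ∈ lowerPB θ T₀ z₀.1 z₀.2) (hz₁A : z₁ ∈ closedContactSet a v) :
    ∃ (e : Space n × ℝ) (x : Space n) (t : ℝ),
      ∀ e' ∈ Metric.closedBall x (r / 60) ×ˢ Icc (t - 2 * (r / 60) ^ 2) (t - (r / 60) ^ 2),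
        ∃ w ∈ midCylinder θ r z.2 c ∩ closedContactSet (openingFactor lam Lam * a) v,
          TouchesBelow (fun w => concaveParabola a e.1 e.2 w +
            concaveParabola (18 * growthConst lam Lam * a) e'.1 e'.2 w) v w.1 w.2 := by
  have hr := h.pos
  have hb₀ : 0 < 18 * growthConst lam Lam * a := by
    have := hell.one_le_growthConst
    positivity
  obtain ⟨-, e, he, htouch⟩ := hz₁A
  obtain ⟨x, hx, hnear⟩ := h.exists_le_concaveParabola_add hv hell ha
    ((mul_le_mul_of_nonneg_right hell.growthConst_le_smallnessFactor ha.le).trans_lt hδ)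
    hθ hθ4 hQ hz hz₁ htouch
  have hmid : midCylinder θ r z.2 c ⊆ Q₁ n :=
    (h.midCylinder_subset_lowerPB (by linarith) hz).trans hQ
  have hcyl := cylinder_subset_midCylinder hθ r z.2 c
  set t : ℝ := z.2 + 5 * (θ * r ^ 2) / 8
  have hxt : (x, t) ∈ midCylinder θ r z.2 c :=
    hcyl ⟨Metric.closedBall_subset_closedBall (by linarith) hx,
      by simp only; linarith [sq_nonneg (r / 60)], le_rfl⟩
  have hbelow : LiesBelow (concaveParabola a e.1 e.2) v t :=
    htouch.1.mono (h.lt_contact_time (by linarith) hxt).le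
  refine ⟨e, x, t, fun e' he' => ?_⟩
  obtain ⟨w, hw, hwtouch⟩ := hbelow.exists_touchesBelow_add_of_near hv.continuousOn hb₀
    (d := r / 60) (by positivity) (mem_closedBall_of_mem_Q₁ (hmid hxt))
    (hnear.trans_eq (by ring)) he'
  have he'c : ‖e'.1 - c‖ ≤ r / 15 := by
    linarith [norm_sub_le_norm_sub_add_norm_sub e'.1 x c, mem_closedBall_iff_norm.1 hx,
      mem_closedBall_iff_norm.1 he'.1]
  have hwc : ‖w.1 - c‖ ≤ r / 10 := by
    linarith [norm_sub_le_norm_sub_add_norm_sub w.1 e'.1 c, mem_closedBall_iff_norm.1 hw.1]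
  have he'mid : e' ∈ midCylinder θ r z.2 c := hcyl ⟨mem_closedBall_iff_norm.2 (by linarith),
    he'.2.1, he'.2.2.trans (sub_le_self _ (sq_nonneg _))⟩
  have hwmid : w ∈ midCylinder θ r z.2 c :=
    hcyl ⟨mem_closedBall_iff_norm.2 hwc, he'.2.1.trans hw.2.1, hw.2.2⟩
  refine ⟨w, ⟨hwmid, ?_⟩, hwtouch⟩
  rw [openingFactor_mul]
  exact mem_closedContactSet_add hv₀ ha hb₀ he (Q₁_subset_closedQ₁ (hmid he'mid)) (hmid hwmid)
    hwtouch

lemma IsMiddleConfiguration.volume_le_midCylinder_inter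
    (h : IsMiddleConfiguration θ r R z z₁ z₀ c) (hv : IsEllipticSupersolution lam Lam δ v)
    (hell : IsEllipticityPair lam Lam) (hv₀ : ∀ z ∈ Q₁ n, 0 ≤ v z) (ha : 0 < a)
    (hδ : smallnessFactor lam Lam * a < δ) (hθ : 3 / 4 ≤ θ) (hθ4 : θ ≤ 4)
    (hQ : lowerPB θ T₀ z₀.1 z₀.2 ⊆ Q₁ n) (hz : z ∈ lowerPB θ T₀ z₀.1 z₀.2)
    (hz₁ : z₁ ∈ lowerPB θ T₀ z₀.1 z₀.2) (hz₁A : z₁ ∈ closedContactSet a v) :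
    ENNReal.ofReal ((r / 60) ^ n * (r / 60) ^ 2) * volume (Metric.ball (0 : Space n) 1) ≤
      ENNReal.ofReal (vertexConst n lam Lam) *
        volume (midCylinder θ r z.2 c ∩ closedContactSet (openingFactor lam Lam * a) v) := by
  have hr := h.pos
  obtain ⟨e, x, t, htouch⟩ :=
    h.exists_touchesBelow_midCylinder hv hell hv₀ ha hδ hθ hθ4 hQ hz hz₁ hz₁A
  have hvertices := hv.volume_vertices_le hell ha
    (le_mul_of_one_le_left ha.le (by linarith [hell.one_le_growthConst]))
    (by rwa [← openingFactor_mul, ← mul_assoc])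
    (inter_subset_left.trans ((h.midCylinder_subset_lowerPB (by linarith) hz).trans hQ)) htouch
  rwa [volume_cylinder _ (by positivity),
    show t - (r / 60) ^ 2 - (t - 2 * (r / 60) ^ 2) = (r / 60) ^ 2 by ring] at hvertices

end MiddleGrowth

section Decay

variable {n : ℕ} {lam Lam δ θ T₀ r r' R R' a : ℝ} {v : Space n × ℝ → ℝ}
  {z z' z₁ z₁' z₀ z₀' : Space n × ℝ} {c c' : Space n}

/-- The cylinder about `z` which, in the covering argument, stands for the middle cylinder belonging
to `z` and to the radius `r`. -/
def coverCylinder (r : ℝ) (z : Space n × ℝ) : Set (Space n × ℝ) :=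
  Metric.closedBall z.1 (3 * r) ×ˢ Icc (z.2 - 15 * r ^ 2) (z.2 + 15 * r ^ 2)

lemma IsMiddleConfiguration.mem_coverCylinder (hθ : 0 < θ) (hθ4 : θ ≤ 4)
    (h : IsMiddleConfiguration θ r R z z₁ z₀ c)
    (h' : IsMiddleConfiguration θ r' R' z' z₁' z₀' c')
    (hmeet : (midCylinder θ r z.2 c ∩ midCylinder θ r' z'.2 c').Nonempty) (hr : r ≤ 2 * r') :
    z ∈ coverCylinder r' z' := by
  obtain ⟨p, hp, hp'⟩ := hmeet
  have hpz := h.norm_sub_base_le hp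
  rw [norm_sub_rev] at hpz
  have hr_sq : r ^ 2 ≤ 4 * r' ^ 2 := by
    calc r ^ 2 ≤ (2 * r') ^ 2 := pow_le_pow_left₀ h.pos.le hr 2
      _ = 4 * r' ^ 2 := by ring
  have hθr : θ * r ^ 2 ≤ 4 * (4 * r' ^ 2) := by gcongr
  have hθr' : θ * r' ^ 2 ≤ 4 * r' ^ 2 := by gcongr
  have hθr'₀ : 0 ≤ θ * r' ^ 2 := by positivity
  have hθr₀ : 0 ≤ θ * r ^ 2 := by positivity
  refine ⟨mem_closedBall_iff_norm.2 ?_, ?_, ?_⟩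
  · linarith [norm_sub_le_norm_sub_add_norm_sub z.1 p.1 z'.1, h'.norm_sub_base_le hp', h'.pos]
  · linarith [hp.2.2, hp'.2.1]
  · linarith [hp.2.1, hp'.2.2]

lemma IsMiddleConfiguration.radius_le (h : IsMiddleConfiguration θ r R z z₁ z₀ c) (hθ : 0 < θ)
    (hz : z₀.2 - z.2 ≤ T₀) : r ≤ √(T₀ / θ) := by
  refine Real.le_sqrt_of_sq_le ((le_div_iff₀ hθ).2 ?_)
  calc r ^ 2 * θ ≤ R ^ 2 * θ := by
        have := h.pos
        gcongr
        exact h.le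
    _ ≤ T₀ := by linarith [h.apex_time]

/-- The constant in the covering argument. -/
noncomputable def coverConst (n : ℕ) (lam Lam : ℝ) : ℝ :=
  180 ^ n * 108000 * vertexConst n lam Lam

lemma IsEllipticityPair.coverConst_pos (hell : IsEllipticityPair lam Lam) :
    0 < coverConst n lam Lam := by
  have := hell.vertexConst_pos (n := n)
  rw [coverConst]
  positivity

lemma volume_coverCylinder (hr : 0 ≤ r) (z : Space n × ℝ) :
    volume (coverCylinder r z) = ENNReal.ofReal (180 ^ n * 108000) *
      (ENNReal.ofReal ((r / 60) ^ n * (r / 60) ^ 2) * volume (Metric.ball (0 : Space n) 1)) := by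
  rw [coverCylinder, volume_cylinder _ (by positivity), ← mul_assoc,
    ← ENNReal.ofReal_mul (by positivity)]
  congr 2
  rw [show 3 * r = 180 * (r / 60) by ring, mul_pow]
  ring

lemma IsEllipticSupersolution.volume_diff_le (hv : IsEllipticSupersolution lam Lam δ v)
    (hell : IsEllipticityPair lam Lam) (hv₀ : ∀ z ∈ Q₁ n, 0 ≤ v z) (ha : 0 < a)
    (hδ : smallnessFactor lam Lam * a < δ) (hθ : 3 / 4 ≤ θ) (hθ4 : θ ≤ 4) (hT₀ : 0 ≤ T₀)
    (hQ : lowerPB θ T₀ z₀.1 z₀.2 ⊆ Q₁ n) (hz₀ : z₀ ∈ closedContactSet a v) :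
    volume (lowerPB θ T₀ z₀.1 z₀.2 \ closedContactSet a v) ≤
      ENNReal.ofReal (coverConst n lam Lam) *
        volume ((lowerPB θ T₀ z₀.1 z₀.2 \ closedContactSet a v) ∩
          closedContactSet (openingFactor lam Lam * a) v) := by
  have hθ₀ : 0 < θ := by linarith
  set P := lowerPB θ T₀ z₀.1 z₀.2
  set A := closedContactSet a v
  set A' := closedContactSet (openingFactor lam Lam * a) v
  have hPA : IsCompact (P ∩ A) :=
    isCompact_inter_closedContactSet hv.continuousOn (isCompact_lowerPB hQ) hQ a
  have hPA' : IsCompact (P ∩ A') :=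
    isCompact_inter_closedContactSet hv.continuousOn (isCompact_lowerPB hQ) hQ _
  have hconfig (z : ↥(P \ A)) : ∃ r R z₁ c, z₁ ∈ P ∩ A ∧
      IsMiddleConfiguration θ r R z z₁ z₀ c ∧
      ∀ w ∈ P ∩ A, θ * ‖w.1 - z.1.1‖ ^ 2 ≤ w.2 - z.1.2 → z₁.2 ≤ w.2 :=
    exists_isMiddleConfiguration hθ₀ hPA ⟨apex_mem_lowerPB hT₀, hz₀⟩ z.2.1.1
      fun hz => z.2.2 hz.2
  choose r R z₁ c hz₁ hmid hfirst using hconfig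
  have hmidP (z : ↥(P \ A)) : midCylinder θ (r z) z.1.2 (c z) ⊆ P :=
    (hmid z).midCylinder_subset_lowerPB hθ₀ z.2.1
  have hmidA (z : ↥(P \ A)) : midCylinder θ (r z) z.1.2 (c z) ⊆ P \ A := fun w hw =>
    ⟨hmidP z hw, fun hwA => ((hmid z).lt_contact_time hθ₀ hw).not_ge
      (hfirst z w ⟨hmidP z hw, hwA⟩ ((hmid z).mul_norm_sub_base_sq_le hθ₀ hw))⟩
  refine measure_le_mul_of_disjoint_subfamily (μ := volume) (r := r) (R := √(T₀ / θ))
    (B := fun z => midCylinder θ (r z) z.1.2 (c z))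
    (D := fun z => midCylinder θ (r z) z.1.2 (c z) ∩ A') (S := fun z => coverCylinder (r z) z)
    (fun z => (hmid z).pos.le) (fun z => (hmid z).radius_le hθ₀ z.2.1.2)
    (fun z => nonempty_interior_midCylinder hθ₀ (hmid z).pos _ _)
    (fun z z' => (hmid z).mem_coverCylinder hθ₀ hθ4 (hmid z'))
    (fun z => inter_subset_left) (fun z => inter_subset_inter_left _ (hmidA z))
    (fun z => ?_) (fun z => ?_)
  · rw [← inter_eq_self_of_subset_left (hmidP z), inter_assoc]
    exact (isClosed_midCylinder _ _ _ _).measurableSet.inter hPA'.isClosed.measurableSet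
  · rw [volume_coverCylinder (hmid z).pos.le, coverConst,
      ENNReal.ofReal_mul (q := vertexConst n lam Lam) (by positivity), mul_assoc]
    exact mul_le_mul_right ((hmid z).volume_le_midCylinder_inter hv hell hv₀ ha hδ hθ hθ4 hQ z.2.1
      (hz₁ z).1 (hz₁ z).2) _

lemma measure_sdiff_le_of_measure_le_mul {α : Type*} [MeasurableSpace α] {μ : Measure α}
    {D X : Set α} {C : ℝ} (hX : MeasurableSet X) (hXD : X ⊆ D) (hD : μ D ≠ ⊤) (hC : 0 ≤ C)
    (h : μ D ≤ ENNReal.ofReal C * μ X) :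
    μ (D \ X) ≤ ENNReal.ofReal (1 - 1 / (1 + C)) * μ D := by
  have hXfin : μ X ≠ ⊤ := measure_ne_top_of_subset hXD hD
  have hreal : μ.real D ≤ C * μ.real X := by
    simpa [measureReal_def, ENNReal.toReal_ofReal hC] using
      ENNReal.toReal_mono (ENNReal.mul_ne_top ENNReal.ofReal_ne_top hXfin) h
  have hfraction : 1 / (1 + C) * μ.real D ≤ μ.real X := by
    rw [one_div, inv_mul_le_iff₀ (by positivity)]
    linarith [measureReal_nonneg (μ := μ) (s := X)]
  have hC_inv : 1 / (1 + C) ≤ 1 := (div_le_one (by positivity)).2 (by linarith)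
  rw [← ofReal_measureReal (measure_ne_top_of_subset sdiff_subset hD), ← ofReal_measureReal hD,
    ← ENNReal.ofReal_mul (sub_nonneg.2 hC_inv), measureReal_sdiff hXD hX hD]
  exact ENNReal.ofReal_le_ofReal (by linarith)

/-- The fraction of the measure gained in one step of the decay. -/
noncomputable def gain (n : ℕ) (lam Lam : ℝ) : ℝ := 1 / (1 + coverConst n lam Lam)

lemma IsEllipticityPair.gain_mem_Ioo (hell : IsEllipticityPair lam Lam) :
    gain n lam Lam ∈ Ioo 0 1 := by
  have := hell.coverConst_pos (n := n)
  exact ⟨by rw [gain]; positivity, (div_lt_one (by positivity)).2 (by linarith)⟩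

lemma IsEllipticSupersolution.volume_diff_step (hv : IsEllipticSupersolution lam Lam δ v)
    (hell : IsEllipticityPair lam Lam) (hv₀ : ∀ z ∈ Q₁ n, 0 ≤ v z) (ha : 0 < a)
    (hδ : smallnessFactor lam Lam * a < δ) (hθ : 3 / 4 ≤ θ) (hθ4 : θ ≤ 4) (hT₀ : 0 ≤ T₀)
    (hQ : lowerPB θ T₀ z₀.1 z₀.2 ⊆ Q₁ n) (hz₀ : z₀ ∈ closedContactSet a v) :
    volume (lowerPB θ T₀ z₀.1 z₀.2 \ closedContactSet (openingFactor lam Lam * a) v) ≤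
      ENNReal.ofReal (1 - gain n lam Lam) *
        volume (lowerPB θ T₀ z₀.1 z₀.2 \ closedContactSet a v) := by
  have hfilled := hv.volume_diff_le hell hv₀ ha hδ hθ hθ4 hT₀ hQ hz₀
  set P := lowerPB θ T₀ z₀.1 z₀.2
  set A := closedContactSet a v
  set A' := closedContactSet (openingFactor lam Lam * a) v
  have hP : IsCompact P := isCompact_lowerPB hQ
  have hAA' : A ⊆ A' := closedContactSet_mono hv.continuousOn hv₀ ha
    (le_mul_of_one_le_left ha.le hell.one_le_openingFactor)
  have hmeas : MeasurableSet ((P \ A) ∩ A') := by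
    have hclosed (a : ℝ) : IsClosed (P ∩ closedContactSet a v) :=
      (isCompact_inter_closedContactSet hv.continuousOn hP hQ a).isClosed
    convert (hclosed (openingFactor lam Lam * a)).measurableSet.diff (hclosed a).measurableSet
      using 1
    grind
  have hdiff : P \ A' = (P \ A) \ ((P \ A) ∩ A') := by
    rw [sdiff_self_inter, sdiff_sdiff, union_eq_self_of_subset_left hAA']
  rw [hdiff]
  exact measure_sdiff_le_of_measure_le_mul hmeas inter_subset_left
    (measure_ne_top_of_subset sdiff_subset hP.measure_ne_top) hell.coverConst_pos.le hfilled

lemma IsEllipticSupersolution.volume_diff_iterate (hv : IsEllipticSupersolution lam Lam δ v)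
    (hell : IsEllipticityPair lam Lam) (hv₀ : ∀ z ∈ Q₁ n, 0 ≤ v z) (ha : 0 < a)
    (hθ : 3 / 4 ≤ θ) (hθ4 : θ ≤ 4) (hT₀ : 0 ≤ T₀) (hQ : lowerPB θ T₀ z₀.1 z₀.2 ⊆ Q₁ n)
    (hz₀ : z₀ ∈ closedContactSet a v) {k : ℕ}
    (hδ : ∀ j < k, smallnessFactor lam Lam * (openingFactor lam Lam ^ j * a) < δ) :
    volume (lowerPB θ T₀ z₀.1 z₀.2 \ closedContactSet (openingFactor lam Lam ^ k * a) v) ≤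
      ENNReal.ofReal ((1 - gain n lam Lam) ^ k) * volume (lowerPB θ T₀ z₀.1 z₀.2) := by
  have hK := hell.one_le_openingFactor
  induction k with
  | zero => simpa using measure_mono sdiff_subset
  | succ k ih =>
    have hstep := hv.volume_diff_step hell hv₀ (a := openingFactor lam Lam ^ k * a) (by positivity)
      (hδ k k.lt_succ_self) hθ hθ4 hT₀ hQ (closedContactSet_mono hv.continuousOn hv₀ ha
        (le_mul_of_one_le_left ha.le (one_le_pow₀ hK)) hz₀)
    rw [← mul_assoc, ← pow_succ'] at hstep
    calc _ ≤ _ := hstep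
      _ ≤ ENNReal.ofReal (1 - gain n lam Lam) *
          (ENNReal.ofReal ((1 - gain n lam Lam) ^ k) * volume (lowerPB θ T₀ z₀.1 z₀.2)) :=
        mul_le_mul_right (ih fun j hj => hδ j (hj.trans k.lt_succ_self)) _
      _ = _ := by
        rw [← mul_assoc, ← ENNReal.ofReal_mul (sub_nonneg.2 hell.gain_mem_Ioo.2.le), pow_succ']

end Decay

section Iteration

variable {n : ℕ} {lam Lam δ a : ℝ}

/-- The ratio between consecutive openings in the decay estimate, small enough both for the gain in
measure and for the openings that occur to stay in the range where the equation is elliptic. -/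
noncomputable def decayConst (n : ℕ) (lam Lam : ℝ) : ℝ :=
  min (gain n lam Lam) (1 / (2 * smallnessFactor lam Lam))

lemma IsEllipticityPair.decayConst_mem_Ioo (hell : IsEllipticityPair lam Lam) :
    decayConst n lam Lam ∈ Ioo 0 1 := by
  have hL := hell.smallnessFactor_pos
  exact ⟨lt_min hell.gain_mem_Ioo.1 (by positivity), (min_le_left _ _).trans_lt hell.gain_mem_Ioo.2⟩

lemma IsEllipticityPair.smallnessFactor_lt_inv_decayConst (hell : IsEllipticityPair lam Lam) :
    smallnessFactor lam Lam < (decayConst n lam Lam)⁻¹ := by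
  have hL := hell.smallnessFactor_pos
  calc smallnessFactor lam Lam < 2 * smallnessFactor lam Lam := by linarith
    _ ≤ (decayConst n lam Lam)⁻¹ := by
      rw [le_inv_comm₀ (by positivity) hell.decayConst_mem_Ioo.1, ← one_div]
      exact min_le_right _ _

lemma IsEllipticityPair.openingFactor_lt_inv_decayConst (hell : IsEllipticityPair lam Lam) :
    openingFactor lam Lam < (decayConst n lam Lam)⁻¹ :=
  hell.openingFactor_le_smallnessFactor.trans_lt hell.smallnessFactor_lt_inv_decayConst

lemma IsEllipticityPair.smallnessFactor_mul_lt (hell : IsEllipticityPair lam Lam) (ha : 0 < a)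
    {j k : ℕ} (hjk : j < k) (hk : (decayConst n lam Lam)⁻¹ ^ k * a ≤ δ) :
    smallnessFactor lam Lam * (openingFactor lam Lam ^ j * a) < δ := by
  have hc := hell.decayConst_mem_Ioo (n := n)
  have hc₀ : 0 < (decayConst n lam Lam)⁻¹ := inv_pos.2 hc.1
  have hK := hell.one_le_openingFactor
  calc smallnessFactor lam Lam * (openingFactor lam Lam ^ j * a)
      < (decayConst n lam Lam)⁻¹ * (openingFactor lam Lam ^ j * a) := by
        gcongr
        exact hell.smallnessFactor_lt_inv_decayConst
    _ ≤ (decayConst n lam Lam)⁻¹ * ((decayConst n lam Lam)⁻¹ ^ j * a) := by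
        gcongr
        exact hell.openingFactor_lt_inv_decayConst.le
    _ = (decayConst n lam Lam)⁻¹ ^ (j + 1) * a := by ring
    _ ≤ (decayConst n lam Lam)⁻¹ ^ k * a := by
        gcongr
        · exact (one_le_inv₀ hc.1).2 hc.2.le
        · exact hjk
    _ ≤ δ := hk

lemma isEllipticityPair_min_max (hlam : 0 < lam) : IsEllipticityPair (min lam 1) (max Lam 1) :=
  ⟨lt_min hlam one_pos, min_le_right _ _, le_max_right _ _⟩

lemma sub_sInf_image_nonneg {u : Space n × ℝ → ℝ}
    (hu : ContinuousOn u (Metric.closedBall 0 1 ×ˢ univ)) {z : Space n × ℝ} (hz : z ∈ Q₁ n) :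
    0 ≤ u z - sInf (u '' Q₁ n) :=
  sub_nonneg.2 (csInf_le ((isCompact_closedQ₁.bddBelow_image
    (hu.mono (prod_mono_right (subset_univ _)))).mono (image_mono Q₁_subset_closedQ₁))
    (mem_image_of_mem u hz))

lemma mem_closedContactSet_of_mem_contactSet {u : Space n × ℝ → ℝ}
    (hu : ContinuousOn u (Metric.closedBall 0 1 ×ˢ univ)) {z : Space n × ℝ} (hz : z ∈ Q₁ n)
    (h : z ∈ contactSet a (closedQ₁ n) u) :
    z ∈ closedContactSet a fun w => u w - sInf (u '' Q₁ n) := by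
  obtain ⟨-, y, s, hys, hcontact⟩ := h
  exact mem_closedContactSet_of_contactsBelow (hu.sub continuousOn_const) hys hz hcontact

lemma closedContactSet_subset_contactSet {u : Space n × ℝ → ℝ} {a' : ℝ}
    (hu : ContinuousOn u (Metric.closedBall 0 1 ×ˢ univ)) (ha : 0 < a) (haa' : a < a') :
    closedContactSet a (fun z => u z - sInf (u '' Q₁ n)) ⊆ contactSet a' (closedQ₁ n) u := by
  intro z hz
  obtain ⟨e, he, h⟩ := exists_contactsBelow_of_lt (fun w => sub_sInf_image_nonneg hu) ha haa' hz
  exact ⟨Metric.ball_subset_closedBall hz.1.1, e.1, e.2, he, h⟩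

lemma c₀_le_one (hlam : 0 < lam) (hlam1 : lam ≤ 1) (hLam : 1 ≤ Lam) : c₀ n lam Lam ≤ 1 := by
  have hfrac : lam ^ 2 / (Lam ^ 2 * ((n : ℝ) + 5)) ≤ 1 := by
    refine div_le_one_of_le₀ ?_ (by positivity)
    calc lam ^ 2 ≤ 1 := pow_le_one₀ hlam.le hlam1
      _ ≤ Lam ^ 2 * ((n : ℝ) + 5) :=
        one_le_mul_of_one_le_of_one_le (one_le_pow₀ hLam) (by linarith [n.cast_nonneg (α := ℝ)])
  have hexp : 0 ≤ 10 ^ 3 * Lam * n / lam := by positivity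
  exact mul_le_one₀ hfrac (Real.exp_nonneg _) (Real.exp_le_one_iff.2 (neg_nonpos.2 hexp))

lemma η₂_mem_Ioc (n : ℕ) : η₂ n ∈ Ioc 0 1 := by
  have hn : (0 : ℝ) ≤ n := n.cast_nonneg
  have hsqrt : (1 : ℝ) ≤ √2 + 1 := le_add_of_nonneg_left (Real.sqrt_nonneg 2)
  refine ⟨by unfold η₂; positivity, mul_le_one₀ ?_ (by positivity) ?_⟩
  · exact Real.rpow_le_one_of_one_le_of_nonpos (by norm_num) (by linarith)
  · exact Real.rpow_le_one_of_one_le_of_nonpos hsqrt (neg_nonpos.2 hn)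

end Iteration

end ParabolicContact

theorem proposition3p6_general (n : ℕ) (lam Lam : ℝ) (hlam : 0 < lam) :
    ∃ c₁ : ℝ, 0 < c₁ ∧ c₁ < 1 ∧
      ∀ (δ : ℝ) (F : SymMat n → ℝ), StructureConditions lam Lam δ F →
      ∀ (u : Space n × ℝ → ℝ),
        ContinuousOn u (Metric.closedBall 0 1 ×ˢ univ) →
        IsViscositySupersolution F u →
      ∀ (θ T₀ : ℝ) (x₀ : Space n) (t₀ : ℝ), 3 / 4 ≤ θ → θ ≤ 4 → 0 < T₀ →
        lowerPB θ T₀ x₀ t₀ ⊆ Q₁ n →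
      ∀ (a : ℝ), 0 < a → (x₀, t₀) ∈ contactSet a (closedQ₁ n) u →
      ∀ (k : ℕ), (c₁⁻¹) ^ k * a ≤ δ →
        volume (lowerPB θ T₀ x₀ t₀ \ contactSet ((c₁⁻¹) ^ k * a) (closedQ₁ n) u) ≤
          ENNReal.ofReal ((1 - c₁) ^ k) * volume (lowerPB θ T₀ x₀ t₀) := by
  have hell : IsEllipticityPair (min lam 1) (max Lam 1) := isEllipticityPair_min_max hlam
  have hc := hell.decayConst_mem_Ioo (n := n)
  refine ⟨decayConst n (min lam 1) (max Lam 1), hc.1, hc.2, ?_⟩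
  intro δ F hF u hu hsuper θ T₀ x₀ t₀ hθ hθ4 hT₀ hQ a ha hz₀ k hk
  rcases eq_or_ne k 0 with rfl | hk₀
  · simpa using measure_mono sdiff_subset
  have hK := hell.one_le_openingFactor
  have hv := isEllipticSupersolution_sub_const hell.Lam_pos.le
    (hF.mono (min_le_left lam 1) (le_max_left Lam 1)) hsuper hu (sInf (u '' Q₁ n))
  have hcontact := mem_closedContactSet_of_mem_contactSet hu
    (hQ (apex_mem_lowerPB (z₀ := (x₀, t₀)) hT₀.le)) hz₀
  have hdecay := hv.volume_diff_iterate (z₀ := (x₀, t₀)) hell (fun z => sub_sInf_image_nonneg hu)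
    ha hθ hθ4 hT₀.le hQ hcontact fun j hj => hell.smallnessFactor_mul_lt ha hj hk
  refine (measure_mono (sdiff_subset_sdiff_right (closedContactSet_subset_contactSet hu
    (by positivity) ?_))).trans (hdecay.trans ?_)
  · gcongr
    exact hell.openingFactor_lt_inv_decayConst
  · gcongr
    · exact sub_nonneg.2 hell.gain_mem_Ioo.2.le
    · exact min_le_left _ _

theorem proposition3p6 (n : ℕ) (hn : 1 ≤ n) (lam Lam : ℝ)
    (hlam : 0 < lam) (hlam1 : lam ≤ 1) (hLam : 1 ≤ Lam) :
    ∃ c₁ : ℝ, 0 < c₁ ∧ c₁ < 1 ∧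
      ∀ (δ : ℝ), 0 < δ →
      ∀ (F : SymMat n → ℝ), StructureConditions lam Lam δ F →
      ∀ (u : Space n × ℝ → ℝ),
        ContinuousOn u (Metric.closedBall 0 1 ×ˢ univ) →
        (∃ B : ℝ, ∀ z ∈ (Metric.closedBall 0 1 ×ˢ univ : Set (Space n × ℝ)), |u z| ≤ B) →
        LocallyUniformlySemiconcave u →
        IsViscositySupersolution F u →
      ∀ (θ T₀ : ℝ) (x₀ : Space n) (t₀ : ℝ), 3 / 4 ≤ θ → θ ≤ 4 → 0 < T₀ →
        lowerPB θ T₀ x₀ t₀ ⊆ Q₁ n →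
      ∀ (a : ℝ), 0 < a → a < c₀ n lam Lam * δ →
        (x₀, t₀) ∈ contactSet a (closedQ₁ n) u →
      ∀ (k : ℕ), (c₁⁻¹) ^ k * a ≤ c₀ n lam Lam * δ →
        volume (lowerPB θ T₀ x₀ t₀ \ contactSet ((c₁⁻¹) ^ k * a) (closedQ₁ n) u) ≤
          ENNReal.ofReal ((1 - η₂ n * c₁) ^ k) * volume (lowerPB θ T₀ x₀ t₀) := by
  obtain ⟨c₁, hc₀, hc1, h⟩ := proposition3p6_general n lam Lam hlam
  refine ⟨c₁, hc₀, hc1, ?_⟩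
  intro δ hδ F hF u hu _ _ hsuper θ T₀ x₀ t₀ hθ hθ4 hT₀ hQ a ha _ hz₀ k hk
  refine (h δ F hF u hu hsuper θ T₀ x₀ t₀ hθ hθ4 hT₀ hQ a ha hz₀ k
    (hk.trans (mul_le_of_le_one_left hδ.le (c₀_le_one hlam hlam1 hLam)))).trans ?_
  gcongr
  exact mul_le_of_le_one_left hc₀.le (η₂_mem_Ioc n).2
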